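/- **Definitions.** An election $E=(C,V)$ has candidates $C=\{c_1,\dots,c_m\}$, $m\ge 1$, and an ordered list of voters $V=(v_1,\dots,v_n)$; each voter $v$ has a linear order $\succ_v$ on $C$, and $\mathrm{pos}_v(c)$ is the position of $c$ in it (the top candidate has position $1$). A family of dissatisfaction functions is $\alpha=(\alpha^m)_{m\ge1}$ with each $\alpha^m\colon\{1,\dots,m\}\to\mathbb N$ nondecreasing and $\alpha^m(1)=0$; it is polynomial-time computable if $\alpha^m(i)$ can be computed from $m$ and $i\in\{1,\dots,m\}$ in time polynomial in $m$. For a positive integer $k$, a $k$-CC assignment is a map $\Phi\colon V\to C$ with $|\Phi(V)|\le k$; it is optimal under $\alpha$-$\ell$-CC if it minimizes $\ell(\Phi)$ among all $k$-CC assignments, where $\ell_1(\Phi)=\sum_{i=1}^n\alpha^m(\mathrm{pos}_{v_i}(\Phi(v_i)))$ and $\ell_\infty(\Phi)=\max_{1\le i\le n}\alpha^m(\mathrm{pos}_{v_i}(\Phi(v_i)))$. A profile is single-crossing if for all candidates $a,b$ with $a\succ_{v_1}b$ there is $s\in\{1,\dots,n\}$ with $\{i : a\succ_{v_i}b\}=\{1,\dots,s\}$.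 A set $D\subseteq C$ is a clone set if every voter ranks the members of $D$ consecutively. A partition of $C$ into nonempty sets $D_1,\dots,D_t$ witnesses that $E$ has single-crossing width at most $w$ if each $D_i$ is a clone set with $|D_i|\le w$, and contracting each $D_i$ to a single candidate in every vote gives a single-crossing profile. **Statement.** For every family $\alpha$ of polynomial-time computable dissatisfaction functions and every $\ell\in\{\ell_1,\ell_\infty\}$, there is an algorithm that, given an election $E=(C,V)$ with $m$ candidates and $n$ voters, a partition of $C$ into clone sets witnessing that the single-crossing width of $E$ is at most $w$, and a positive integer $k$, finds an optimal $k$-CC assignment for $E$ under $\alpha$-$\ell$-CC in time $\mathrm{poly}(m,n,k,2^w)$. That is, one algorithm and one polynomial, depending only on $\alpha$ and $\ell$, work for all inputs and all $w$. (Time is the number of steps of a random access machine with addition, truncated subtraction and indirect addressing as unit-cost operations, and no multiplication.) -/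

import Mathlib

/-! ### Elections and Chamberlin–Courant assignments -/

/-- An election with candidates `c_1, …, c_m` and an ordered list of voters `v_1, …, v_n`
(both numbered from `0` here).  The preference order of a voter is a linear order of the
candidates, given by the bijection that sends a candidate to its place (`0` is the top). -/
structure Election (m n : ℕ) where
  place : Fin n → Equiv.Perm (Fin m)

namespace Election

variable {m n : ℕ}

/-- `pos_v(c)`: the position of `c` in the order of `v`; the top candidate has position `1`. -/
def pos (E : Election m n) (v : Fin n) (c : Fin m) : ℕ := (E.place v c : ℕ) + 1

/-- `a ≻_v b`. -/
def Prefers (E : Election m n) (v : Fin n) (a b : Fin m) : Prop := E.pos v a < E.pos v b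

/-- `S` is a clone set: each voter ranks the members of `S` consecutively. -/
def IsCloneSet (E : Election m n) (S : Set (Fin m)) : Prop :=
  ∀ (v : Fin n) (a b c : Fin m), a ∈ S → c ∈ S → E.Prefers v a b → E.Prefers v b c → b ∈ S

end Election

/-- A profile of strict linear orders `R v` of the candidates in `C`, one for each of the voters
`v_1, …, v_n`, is single-crossing (with respect to the given order of the voters): for each pair
`a, b` with `a ≻ b` for the first voter there is `s ∈ [n]` such that the voters with `a ≻ b` are
exactly the first `s` ones. -/
def SingleCrossing {C : Type*} {n : ℕ} (R : Fin n → C → C → Prop) : Prop :=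
  ∀ (hn : 0 < n) (a b : C), R ⟨0, hn⟩ a b →
    ∃ s : ℕ, 1 ≤ s ∧ s ≤ n ∧ ∀ v : Fin n, R v a b ↔ (v : ℕ) < s

/-- The vote of `v` after each set `D_i = {c | D c = i}` has been contracted to a single
candidate `i`: `i` is ranked above `j` if the candidates in `D_i` are ranked above those
in `D_j`. -/
def Election.ContractedPrefers {m n t : ℕ} (E : Election m n) (D : Fin m → Fin t)
    (v : Fin n) (i j : Fin t) : Prop :=
  ∀ a b : Fin m, D a = i → D b = j → E.Prefers v a b

/-- The partition of the candidates into the nonempty sets `D_i = {c | D c = i}`, `i < t`,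
witnesses that the election has single-crossing width at most `w`. -/
structure Election.WitnessesWidth {m n t : ℕ} (E : Election m n) (D : Fin m → Fin t)
    (w : ℕ) : Prop where
  nonempty : Function.Surjective D
  clone : ∀ i : Fin t, E.IsCloneSet {c | D c = i}
  card_le : ∀ i : Fin t, (Finset.univ.filter fun c => D c = i).card ≤ w
  singleCrossing : SingleCrossing (E.ContractedPrefers D)

/-- `α` is a family of dissatisfaction functions: for every `m ≥ 1`, the function
`α m : [m] → ℕ` is nondecreasing with `α m 1 = 0` (values outside `[m]` play no role). -/
structure IsDissatisfactionFamily (α : ℕ → ℕ → ℕ) : Prop where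
  one : ∀ m, 1 ≤ m → α m 1 = 0
  mono : ∀ m i j, 1 ≤ i → i ≤ j → j ≤ m → α m i ≤ α m j

/-- The two ways of aggregating the dissatisfactions of the voters. -/
inductive Aggregation
  | l1
  | linf

/-- `ℓ_1` is the sum and `ℓ_∞` is the maximum. -/
def Aggregation.value (ℓ : Aggregation) {n : ℕ} (x : Fin n → ℕ) : ℕ :=
  match ℓ with
  | .l1 => ∑ v, x v
  | .linf => Finset.univ.sup x

/-- `ℓ(Φ)` for an assignment `Φ` of candidates to voters. -/
def Election.dissatisfaction {m n : ℕ} (E : Election m n) (α : ℕ → ℕ → ℕ) (ℓ : Aggregation)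
    (Φ : Fin n → Fin m) : ℕ :=
  ℓ.value fun v => α m (E.pos v (Φ v))

/-- A `k`-CC assignment function uses at most `k` candidates. -/
def IsCCAssignment {m n : ℕ} (k : ℕ) (Φ : Fin n → Fin m) : Prop :=
  (Finset.univ.image Φ).card ≤ k

/-- `Φ` is an optimal `k`-CC assignment for `E` under `α`-`ℓ`-CC. -/
def Election.IsOptimalCC {m n : ℕ} (E : Election m n) (α : ℕ → ℕ → ℕ) (ℓ : Aggregation)
    (k : ℕ) (Φ : Fin n → Fin m) : Prop :=
  IsCCAssignment k Φ ∧
    ∀ Ψ : Fin n → Fin m, IsCCAssignment k Ψ →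
      E.dissatisfaction α ℓ Φ ≤ E.dissatisfaction α ℓ Ψ

/-! ### Random access machine programs with a step count

Programs act on natural numbers, held in registers and in arrays with indirect addressing.
The arithmetic operations are addition and truncated subtraction, and each operation costs one
step.  Since there is no multiplication, a number grows by at most a constant number of bits in a
step, so polynomial time on this machine is polynomial time on a Turing machine. -/

namespace RAM

/-- The memory: registers `reg x` and arrays `arr a`, with cells `arr a i`. -/
@[ext]
structure Store where
  reg : ℕ → ℕ
  arr : ℕ → ℕ → ℕ

/-- Arithmetic expressions: a constant, the content of a register, the content of the cell of the
array `a` whose index is the value of an expression, a sum, and a truncated difference. -/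
inductive Expr
  | lit (c : ℕ)
  | reg (x : ℕ)
  | cell (a : ℕ) (i : Expr)
  | add (e f : Expr)
  | sub (e f : Expr)

/-- The value of an expression. -/
def Expr.eval (s : Store) : Expr → ℕ
  | .lit c => c
  | .reg x => s.reg x
  | .cell a i => s.arr a (i.eval s)
  | .add e f => e.eval s + f.eval s
  | .sub e f => e.eval s - f.eval s

/-- The number of steps for evaluating an expression. -/
def Expr.cost : Expr → ℕ
  | .lit _ => 1
  | .reg _ => 1
  | .cell _ i => i.cost + 1
  | .add e f => e.cost + f.cost + 1
  | .sub e f => e.cost + f.cost + 1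

/-- Programs.  A procedure call `call x p args` runs `p` on a memory of its own, with the values
of `args` in its first registers and `0` everywhere else, and puts the final content of
the register `0` of `p` into the register `x` of the caller.  There is no recursion. -/
inductive Prog
  | skip
  | setReg (x : ℕ) (e : Expr)
  | setCell (a : ℕ) (i e : Expr)
  | seq (p q : Prog)
  | ite (e : Expr) (p q : Prog)
  | loop (e : Expr) (p : Prog)
  | call (x : ℕ) (p : Prog) (args : List Expr)

/-- Assignment to a register. -/
def Store.setReg (s : Store) (x c : ℕ) : Store :=
  { s with reg := Function.update s.reg x c }

/-- Assignment to a cell of an array. -/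
def Store.setCell (s : Store) (a i c : ℕ) : Store :=
  { s with arr := Function.update s.arr a (Function.update (s.arr a) i c) }

/-- The memory that holds the given numbers in its first registers and `0` everywhere else. -/
def Store.ofArgs (l : List ℕ) : Store where
  reg x := l.getD x 0
  arr _ _ := 0

/-- `Exec p s s' τ`: the program `p`, started in the memory `s`, halts in the memory `s'`
after `τ` steps.  Conditions hold if the value is not `0`; `loop` is a while loop. -/
inductive Exec : Prog → Store → Store → ℕ → Prop
  | skip (s : Store) : Exec .skip s s 1
  | setReg (s : Store) (x : ℕ) (e : Expr) :
      Exec (.setReg x e) s (s.setReg x (e.eval s)) (e.cost + 1)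
  | setCell (s : Store) (a : ℕ) (i e : Expr) :
      Exec (.setCell a i e) s (s.setCell a (i.eval s) (e.eval s)) (i.cost + e.cost + 1)
  | seq {p q : Prog} {s s₁ s₂ : Store} {τ₁ τ₂ : ℕ} :
      Exec p s s₁ τ₁ → Exec q s₁ s₂ τ₂ → Exec (.seq p q) s s₂ (τ₁ + τ₂)
  | iteTrue {e : Expr} {p q : Prog} {s s₁ : Store} {τ : ℕ} :
      e.eval s ≠ 0 → Exec p s s₁ τ → Exec (.ite e p q) s s₁ (e.cost + τ + 1)
  | iteFalse {e : Expr} {p q : Prog} {s s₁ : Store} {τ : ℕ} :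
      e.eval s = 0 → Exec q s s₁ τ → Exec (.ite e p q) s s₁ (e.cost + τ + 1)
  | loopDone {e : Expr} {p : Prog} {s : Store} :
      e.eval s = 0 → Exec (.loop e p) s s (e.cost + 1)
  | loopStep {e : Expr} {p : Prog} {s s₁ s₂ : Store} {τ₁ τ₂ : ℕ} :
      e.eval s ≠ 0 → Exec p s s₁ τ₁ → Exec (.loop e p) s₁ s₂ τ₂ →
        Exec (.loop e p) s s₂ (e.cost + τ₁ + τ₂ + 1)
  | call {p : Prog} {args : List Expr} {s s₁ : Store} {τ : ℕ} (x : ℕ) :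
      Exec p (Store.ofArgs (args.map (Expr.eval s))) s₁ τ →
        Exec (.call x p args) s (s.setReg x (s₁.reg 0)) ((args.map Expr.cost).sum + τ + 1)

/-- The content of an array that holds the numbers `f 0, …, f (N - 1)`, followed by zeros. -/
def table {N : ℕ} (f : Fin N → ℕ) (j : ℕ) : ℕ := if h : j < N then f ⟨j, h⟩ else 0

end RAM

/-- The family `α` is computable in polynomial time with respect to `m`: one program
computes `α m i` from `m` and `i ∈ [m]` in a number of steps that is polynomial in `m`. -/
def PolyTimeComputable (α : ℕ → ℕ → ℕ) : Prop :=
  ∃ (p : RAM.Prog) (q : Polynomial ℕ), ∀ m i : ℕ, 1 ≤ i → i ≤ m →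
    ∃ (s : RAM.Store) (τ : ℕ),
      RAM.Exec p (RAM.Store.ofArgs [m, i]) s τ ∧ τ ≤ q.eval m ∧ s.reg 0 = α m i

/-- The input of the algorithm: the first registers hold `m`, `n`, `k` and the number `t` of sets
in the partition, the array `0` holds `pos_v(c)` in its cell `v * m + c`, and the array `1`
holds, in its cell `c`, the number of the set to which `c` belongs. -/
def inputStore {m n t : ℕ} (E : Election m n) (D : Fin m → Fin t) (k : ℕ) : RAM.Store where
  reg x := [m, n, k, t].getD x 0
  arr a :=
    match a with
    | 0 => RAM.table fun j : Fin (n * m) => E.pos j.divNat j.modNat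
    | 1 => RAM.table fun c : Fin m => (D c : ℕ)
    | _ => fun _ => 0

/-! ### Reasoning about programs -/

namespace RAM

/-! Let `S` be the range of a `k`-CC assignment. Sending each voter to the best member of `S` costs
no more, since dissatisfaction is nondecreasing in the position. The voters served by one block of
the partition are then consecutive (`WitnessesWidth.block_convex`); otherwise the order of two
contracted blocks would change twice along the profile. So it suffices to split the voters into
intervals, give each interval one nonempty subset of a block (an item), and let each voter take the
best candidate of the item. The items `S ∩ D_i` are disjoint, so their sizes sum to at most `k`.

The dynamic program minimizes over the larger family `allAssign`, in which items may recur or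
overlap and each new interval pays the full size of its item. This is harmless: the union of the
items still has at most `k` elements (`exists_superset_of_mem_allAssign`), while
`WitnessesWidth.exists_mem_allAssign` finds in the family a competitor to every `k`-CC assignment.
Hence a cheapest member is optimal (`WitnessesWidth.exists_isOptimalCC`). Both aggregations apply a
monotone operation voter by voter, so cheapest partial assignments extend to cheapest ones
(`IsCell.cons`).

There are at most `t * 2 ^ w` items (`IsFullSetTree.card_le`). They are generated without repetition
as a tree, in which a voter's best candidate in a set follows from the best one in its parent. A
state consists of a voter, a budget `κ ≤ k` and a last item; the assignments are linked lists with
shared tails. The program is verified with time-bounded triples `Runs`, a frame property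
(`Exec.agree`) and a rule for counting loops (`Runs.for`). Finally `t ≤ m` makes the bound
polynomial in `m`, `n`, `k` and `2 ^ w`. -/

@[simp] theorem Store.setReg_reg (s : Store) (x c y : ℕ) :
    (s.setReg x c).reg y = if y = x then c else s.reg y := by
  simp [Store.setReg, Function.update_apply]

@[simp] theorem Store.setReg_arr (s : Store) (x c : ℕ) : (s.setReg x c).arr = s.arr := rfl

@[simp] theorem Store.setCell_reg (s : Store) (a i c : ℕ) : (s.setCell a i c).reg = s.reg := rfl

@[simp] theorem Store.setCell_arr_same (s : Store) (a i c : ℕ) :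
    (s.setCell a i c).arr a = Function.update (s.arr a) i c := by
  simp [Store.setCell]

theorem Store.setCell_arr (s : Store) (a i c b : ℕ) :
    (s.setCell a i c).arr b = if b = a then Function.update (s.arr a) i c else s.arr b := by
  simp [Store.setCell, Function.update_apply]

/-- The registers that a program may change. -/
def Prog.wregs : Prog → List ℕ
  | .skip => []
  | .setReg x _ => [x]
  | .setCell _ _ _ => []
  | .seq p q => p.wregs ++ q.wregs
  | .ite _ p q => p.wregs ++ q.wregs
  | .loop _ p => p.wregs
  | .call x _ _ => [x]

/-- The arrays that a program may change. -/
def Prog.warrs : Prog → List ℕ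
  | .skip => []
  | .setReg _ _ => []
  | .setCell a _ _ => [a]
  | .seq p q => p.warrs ++ q.warrs
  | .ite _ p q => p.warrs ++ q.warrs
  | .loop _ p => p.warrs
  | .call _ _ _ => []

/-- Two memories agree outside the given registers and arrays. -/
def Agree (R A : List ℕ) (s s' : Store) : Prop :=
  (∀ x, x ∉ R → s'.reg x = s.reg x) ∧ ∀ a, a ∉ A → s'.arr a = s.arr a

theorem Agree.refl (R A : List ℕ) (s : Store) : Agree R A s s :=
  ⟨fun _ _ => rfl, fun _ _ => rfl⟩

theorem Agree.trans {R A : List ℕ} {s s₁ s₂ : Store} (h : Agree R A s s₁)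
    (h' : Agree R A s₁ s₂) : Agree R A s s₂ :=
  ⟨fun x hx => (h'.1 x hx).trans (h.1 x hx), fun a ha => (h'.2 a ha).trans (h.2 a ha)⟩

theorem Agree.mono {R A R' A' : List ℕ} {s s' : Store} (h : Agree R A s s')
    (hR : R ⊆ R') (hA : A ⊆ A') : Agree R' A' s s' :=
  ⟨fun x hx => h.1 x fun h' => hx (hR h'), fun a ha => h.2 a fun h' => ha (hA h')⟩

/-- Frame property: what a program may write can be read off its syntax, and a call writes only its
result register. Later proofs thus reduce the preservation of a register or array to a membership
check in a concrete list. -/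
theorem Exec.agree {p : Prog} {s s' : Store} {τ : ℕ} (h : Exec p s s' τ) :
    Agree p.wregs p.warrs s s' := by
  induction h with
  | skip s => exact Agree.refl _ _ _
  | setReg s x e => exact ⟨fun y hy => by simp_all [Prog.wregs], fun _ _ => rfl⟩
  | setCell s a i e =>
    exact ⟨fun _ _ => rfl, fun b hb => by simp_all [Prog.warrs, Store.setCell_arr]⟩
  | seq _ _ ih₁ ih₂ =>
    exact (ih₁.mono (by simp [Prog.wregs]) (by simp [Prog.warrs])).trans
      (ih₂.mono (by simp [Prog.wregs]) (by simp [Prog.warrs]))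
  | iteTrue _ _ ih => exact ih.mono (by simp [Prog.wregs]) (by simp [Prog.warrs])
  | iteFalse _ _ ih => exact ih.mono (by simp [Prog.wregs]) (by simp [Prog.warrs])
  | loopDone _ => exact Agree.refl _ _ _
  | loopStep _ _ _ ih₁ ih₂ => exact Agree.trans ih₁ ih₂
  | call x _ _ => exact ⟨fun y hy => by simp_all [Prog.wregs], fun _ _ => rfl⟩

/-! ### Time-bounded Hoare triples -/

/-- Started in `s`, the program halts within `T` steps in a memory with the property `Q`. -/
def Runs (p : Prog) (s : Store) (T : ℕ) (Q : Store → Prop) : Prop :=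
  ∃ s' τ, Exec p s s' τ ∧ τ ≤ T ∧ Q s'

theorem Runs.mono {p : Prog} {s : Store} {T T' : ℕ} {Q Q' : Store → Prop}
    (h : Runs p s T Q) (hT : T ≤ T') (hQ : ∀ s', Q s' → Q' s') : Runs p s T' Q' :=
  let ⟨s', τ, h₁, h₂, h₃⟩ := h
  ⟨s', τ, h₁, h₂.trans hT, hQ s' h₃⟩

theorem Runs.agree {p : Prog} {s : Store} {T : ℕ} {Q : Store → Prop} (h : Runs p s T Q) :
    Runs p s T fun s' => Agree p.wregs p.warrs s s' ∧ Q s' :=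
  let ⟨s', τ, h₁, h₂, h₃⟩ := h
  ⟨s', τ, h₁, h₂, h₁.agree, h₃⟩

theorem Runs.seq {p q : Prog} {s : Store} {T₁ T₂ : ℕ} {R Q : Store → Prop}
    (hp : Runs p s T₁ R)
    (hq : ∀ s₁, Agree p.wregs p.warrs s s₁ → R s₁ → Runs q s₁ T₂ Q) :
    Runs (.seq p q) s (T₁ + T₂) Q := by
  obtain ⟨s₁, τ₁, h₁, hτ₁, hag, hR⟩ := hp.agree
  obtain ⟨s₂, τ₂, h₂, hτ₂, hQ⟩ := hq s₁ hag hR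
  exact ⟨s₂, τ₁ + τ₂, .seq h₁ h₂, by omega, hQ⟩

theorem Runs.call {p : Prog} {args : List Expr} {s : Store} {T : ℕ} {Q : Store → Prop} (x : ℕ)
    (h : Runs p (Store.ofArgs (args.map (Expr.eval s))) T fun s₁ => Q (s.setReg x (s₁.reg 0))) :
    Runs (.call x p args) s ((args.map Expr.cost).sum + T + 1) Q := by
  obtain ⟨s₁, τ, h₁, hτ, hQ⟩ := h
  exact ⟨_, _, .call x h₁, by omega, hQ⟩

/-- A program without loops and calls. -/
def Prog.straight : Prog → Bool
  | .seq p q => p.straight && q.straight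
  | .ite _ p q => p.straight && q.straight
  | .loop _ _ => false
  | .call _ _ _ => false
  | _ => true

/-- The effect of a program without loops and calls. -/
def Prog.run : Prog → Store → Store
  | .setReg x e, s => s.setReg x (e.eval s)
  | .setCell a i e, s => s.setCell a (i.eval s) (e.eval s)
  | .seq p q, s => q.run (p.run s)
  | .ite e p q, s => if e.eval s = 0 then q.run s else p.run s
  | _, s => s

/-- A bound on the number of steps of a program without loops and calls. -/
def Prog.bound : Prog → ℕ
  | .setReg _ e => e.cost + 1
  | .setCell _ i e => i.cost + e.cost + 1
  | .seq p q => p.bound + q.bound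
  | .ite e p q => e.cost + (p.bound + q.bound) + 1
  | _ => 1

theorem Prog.exec_run {p : Prog} (hp : p.straight = true) (s : Store) :
    ∃ τ ≤ p.bound, Exec p s (p.run s) τ := by
  induction p generalizing s with
  | skip => exact ⟨_, le_rfl, .skip s⟩
  | setReg x e => exact ⟨_, le_rfl, .setReg s x e⟩
  | setCell a i e => exact ⟨_, le_rfl, .setCell s a i e⟩
  | seq p q ihp ihq =>
    simp only [straight, Bool.and_eq_true] at hp
    obtain ⟨τ₁, h₁, e₁⟩ := ihp hp.1 s
    obtain ⟨τ₂, h₂, e₂⟩ := ihq hp.2 (p.run s)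
    exact ⟨_, Nat.add_le_add h₁ h₂, .seq e₁ e₂⟩
  | ite e p q ihp ihq =>
    simp only [straight, Bool.and_eq_true] at hp
    obtain ⟨τ₁, h₁, e₁⟩ := ihp hp.1 s
    obtain ⟨τ₂, h₂, e₂⟩ := ihq hp.2 s
    by_cases he : e.eval s = 0
    · refine ⟨_, ?_, by simpa [run, he] using Exec.iteFalse (p := p) he e₂⟩
      simp only [bound]; omega
    · refine ⟨_, ?_, by simpa [run, he] using Exec.iteTrue (q := q) he e₁⟩
      simp only [bound]; omega
  | loop e p => simp [straight] at hp
  | call x p args => simp [straight] at hp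

theorem Runs.straight {p : Prog} (hp : p.straight = true) {s : Store} {Q : Store → Prop}
    (hQ : Q (p.run s)) : Runs p s p.bound Q :=
  let ⟨τ, h, e⟩ := Prog.exec_run hp s
  ⟨_, τ, e, h, hQ⟩

/-- Run `p` with the register `i` holding `0, 1, …`, up to the content of the register `x`. -/
def Prog.for (i x : ℕ) (p : Prog) : Prog :=
  .seq (.setReg i (.lit 0))
    (.loop (.sub (.reg x) (.reg i)) (.seq p (.setReg i (.add (.reg i) (.lit 1)))))

@[simp] theorem Prog.for_wregs (i x : ℕ) (p : Prog) :
    (Prog.for i x p).wregs = i :: (p.wregs ++ [i]) := rfl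

@[simp] theorem Prog.for_warrs (i x : ℕ) (p : Prog) :
    (Prog.for i x p).warrs = p.warrs ++ [] := rfl

/-- Invariant rule for counting loops. The body may write neither the counter nor the bound, so the
truncated difference of the two counts the remaining rounds. The 8 steps added per round pay for the
test and the increment. -/
theorem Runs.for {i x : ℕ} {p : Prog} {s : Store} {T B : ℕ} (I : ℕ → Store → Prop)
    (hi : i ∉ p.wregs) (hx : x ∉ (Prog.for i x p).wregs) (hB : s.reg x = B)
    (h0 : I 0 (s.setReg i 0))
    (hstep : ∀ j < B, ∀ s', Agree (Prog.for i x p).wregs (Prog.for i x p).warrs s s' →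
      s'.reg i = j → I j s' → Runs p s' T fun s'' => I (j + 1) (s''.setReg i (j + 1))) :
    Runs (Prog.for i x p) s (B * (T + 8) + 8) (I B) := by
  set R := (Prog.for i x p).wregs with hR
  set A := (Prog.for i x p).warrs with hA
  -- Induction on the number `d` of remaining rounds, for an arbitrary intermediate memory.
  have key : ∀ d j s', j + d = B → Agree R A s s' → s'.reg i = j → I j s' →
      Runs (.loop (.sub (.reg x) (.reg i)) (.seq p (.setReg i (.add (.reg i) (.lit 1))))) s'
        (d * (T + 8) + 4) (I B) := by
    intro d
    induction d with
    | zero =>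
      intro j s' hj hag hij hI
      have hxs : s'.reg x = B := (hag.1 x hx).trans hB
      refine ⟨s', _, .loopDone ?_, ?_, ?_⟩
      · simp [Expr.eval, hxs, hij]; omega
      · simp [Expr.cost]
      · rwa [← hj]
    | succ d ih =>
      intro j s' hj hag hij hI
      have hxs : s'.reg x = B := (hag.1 x hx).trans hB
      obtain ⟨s₁, τ₁, e₁, hτ₁, hag₁, hI₁⟩ := (hstep j (by omega) s' hag hij hI).agree
      have hi₁ : s₁.reg i = j := (hag₁.1 i hi).trans hij
      obtain ⟨s₂, τ₂, e₂, hτ₂, hI₂⟩ := ih (j + 1) (s₁.setReg i (j + 1)) (by omega)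
        (hag.trans ⟨fun y hy => by
          have hyi : y ≠ i := by rintro rfl; simp [hR] at hy
          have hyp : y ∉ p.wregs := fun h => hy (by simp [hR, h])
          simp [hyi, hag₁.1 y hyp], fun a ha => by
          have : a ∉ p.warrs := fun h => ha (by simp [hA, h])
          simpa using hag₁.2 a this⟩) (by simp) hI₁
      have e₃ := Exec.setReg s₁ i (.add (.reg i) (.lit 1))
      simp only [Expr.eval, hi₁] at e₃
      refine ⟨s₂, _, .loopStep ?_ (.seq e₁ e₃) e₂, ?_, hI₂⟩
      · simp [Expr.eval, hxs, hij]; omega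
      · simp only [Expr.cost]; ring_nf; ring_nf at hτ₂; omega
  obtain ⟨s₂, τ₂, e₂, hτ₂, hI₂⟩ := key B 0 (s.setReg i 0) (by omega) ⟨fun y hy => by
      have hyi : y ≠ i := by rintro rfl; simp [hR] at hy
      simp [hyi], fun _ _ => rfl⟩ (by simp) h0
  refine ⟨s₂, _, .seq (Exec.setReg s i (.lit 0)) e₂, ?_, hI₂⟩
  simp only [Expr.cost]; omega

end RAM

/-! ### Partial assignments as lists -/

/-- The aggregation of one more dissatisfaction. -/
def Aggregation.op : Aggregation → ℕ → ℕ → ℕ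
  | .l1, x, y => x + y
  | .linf, x, y => max x y

theorem Aggregation.op_le_op (ℓ : Aggregation) {x x' y y' : ℕ} (hx : x ≤ x') (hy : y ≤ y') :
    ℓ.op x y ≤ ℓ.op x' y' := by
  cases ℓ
  · exact Nat.add_le_add hx hy
  · exact max_le_max hx hy

/-- The list `[f (j - 1), …, f 0]`. -/
def prefixList (f : ℕ → ℕ) : ℕ → List ℕ
  | 0 => []
  | j + 1 => f j :: prefixList f j

@[simp] theorem prefixList_length (f : ℕ → ℕ) (j : ℕ) : (prefixList f j).length = j := by
  induction j with
  | zero => rfl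
  | succ j ih => simp [prefixList, ih]

theorem prefixList_congr {f g : ℕ → ℕ} {j : ℕ} (h : ∀ v < j, f v = g v) :
    prefixList f j = prefixList g j := by
  induction j with
  | zero => rfl
  | succ j ih => rw [prefixList, prefixList, h j (by omega), ih fun v hv => h v (by omega)]

theorem mem_prefixList {f : ℕ → ℕ} {j v : ℕ} (h : v < j) : f v ∈ prefixList f j := by
  induction j with
  | zero => omega
  | succ j ih =>
    rcases Nat.lt_succ_iff_lt_or_eq.1 h with h | rfl
    · exact List.mem_cons_of_mem _ (ih h)
    · exact List.mem_cons_self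

theorem exists_eq_prefixList (l : List ℕ) : ∃ f, l = prefixList f l.length := by
  induction l with
  | nil => exact ⟨fun _ => 0, rfl⟩
  | cons c l ih =>
    obtain ⟨f, hf⟩ := ih
    refine ⟨Function.update f l.length c, ?_⟩
    rw [List.length_cons, prefixList, Function.update_self]
    have h : prefixList (Function.update f l.length c) l.length = prefixList f l.length :=
      prefixList_congr fun v hv => Function.update_of_ne (by omega) _ _
    rw [h, ← hf]

/-- The dissatisfaction of an assignment of the first voters, listed with the last one first;
`pen v c` is the dissatisfaction of the voter `v` with the candidate `c`. -/
def listCost (ℓ : Aggregation) (pen : ℕ → ℕ → ℕ) : List ℕ → ℕ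
  | [] => 0
  | c :: l => ℓ.op (listCost ℓ pen l) (pen l.length c)

theorem listCost_prefixList (ℓ : Aggregation) (pen : ℕ → ℕ → ℕ) (f : ℕ → ℕ) (n : ℕ) :
    listCost ℓ pen (prefixList f n) = ℓ.value fun v : Fin n => pen v (f v) := by
  induction n with
  | zero => cases ℓ <;> rfl
  | succ n ih =>
    rw [prefixList, listCost, ih, prefixList_length]
    cases ℓ
    · simp [Aggregation.op, Aggregation.value, Fin.sum_univ_castSucc]
    · simp only [Aggregation.op, Aggregation.value]
      apply le_antisymm
      · refine max_le (Finset.sup_le fun v _ => ?_) ?_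
        · exact Finset.le_sup (f := fun v : Fin (n + 1) => pen v (f v))
            (Finset.mem_univ v.castSucc)
        · exact Finset.le_sup (f := fun v : Fin (n + 1) => pen v (f v))
            (Finset.mem_univ (Fin.last n))
      · refine Finset.sup_le fun v _ => ?_
        induction v using Fin.lastCases with
        | last => exact le_max_right _ _
        | cast v =>
          exact le_max_of_le_left (Finset.le_sup (f := fun v : Fin n => pen v (f v))
            (Finset.mem_univ v))

theorem Aggregation.value_mono (ℓ : Aggregation) {n : ℕ} {x y : Fin n → ℕ} (h : ∀ v, x v ≤ y v) :
    ℓ.value x ≤ ℓ.value y := by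
  cases ℓ
  · exact Finset.sum_le_sum fun v _ => h v
  · exact Finset.sup_mono_fun fun v _ => h v

/-! ### The sets of partial assignments in the dynamic program -/

/-- All partial assignments of the first `j` voters, given those with a fixed last item. -/
def joinItems (N : ℕ) : ℕ → (ℕ → Set (List ℕ)) → Set (List ℕ)
  | 0, _ => {[]}
  | _ + 1, f => {l | ∃ a < N, l ∈ f a}

/-- The assignments of the first `j` voters for which the voters are split into intervals, the
voters in an interval share an item `a < N` (and `row v a` is assigned to `v`), the last
interval has the item `a`, and the sizes of the items have a sum of at most `κ`. -/
def partAssign (row : ℕ → ℕ → ℕ) (size : ℕ → ℕ) (N : ℕ) : ℕ → ℕ → ℕ → Set (List ℕ)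
  | 0, _, _ => ∅
  | j + 1, κ, a => {l | ∃ l' ∈ partAssign row size N j κ a ∪ {l' | size a ≤ κ ∧
      l' ∈ joinItems N j fun b => partAssign row size N j (κ - size a) b}, l = row j a :: l'}

/-- The same with any last item. -/
def allAssign (row : ℕ → ℕ → ℕ) (size : ℕ → ℕ) (N j κ : ℕ) : Set (List ℕ) :=
  joinItems N j (partAssign row size N j κ)

section

variable {row : ℕ → ℕ → ℕ} {size : ℕ → ℕ} {N : ℕ}

theorem mem_partAssign_succ {j κ a : ℕ} {l : List ℕ} :
    l ∈ partAssign row size N (j + 1) κ a ↔ ∃ l' ∈ partAssign row size N j κ a ∪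
      {l' | size a ≤ κ ∧ l' ∈ allAssign row size N j (κ - size a)}, l = row j a :: l' := Iff.rfl

theorem length_of_mem_partAssign {j κ a : ℕ} {l : List ℕ}
    (h : l ∈ partAssign row size N j κ a) : l.length = j := by
  induction j generalizing κ a l with
  | zero => exact h.elim
  | succ j ih =>
    obtain ⟨l', hl | ⟨-, hl⟩, rfl⟩ := mem_partAssign_succ.1 h
    · simp [ih hl]
    · cases j with
      | zero => rw [Set.mem_singleton_iff.1 hl]; rfl
      | succ j => obtain ⟨b, -, hb⟩ := hl; simp [ih hb]

theorem length_of_mem_allAssign {j κ : ℕ} {l : List ℕ}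
    (h : l ∈ allAssign row size N j κ) : l.length = j := by
  cases j with
  | zero => rw [Set.mem_singleton_iff.1 h]; rfl
  | succ j => obtain ⟨b, -, hb⟩ := h; exact length_of_mem_partAssign hb

/-- Soundness of the budget. Carrying the last item inside `U` makes it free to continue an
interval; a new interval enlarges `U` by at most the size of its item, even if items overlap or
recur. -/
theorem exists_superset_of_mem_partAssign {sets : ℕ → Finset ℕ} {X : Finset ℕ}
    {n : ℕ} (hX : ∀ a < N, sets a ⊆ X)
    (hcard : ∀ a < N, (sets a).card ≤ size a) (hrow : ∀ v < n, ∀ a < N, row v a ∈ sets a)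
    {j κ a : ℕ} {l : List ℕ} (hj : j ≤ n) (ha : a < N) (h : l ∈ partAssign row size N j κ a) :
    ∃ U ⊆ X, sets a ⊆ U ∧ U.card ≤ κ ∧ ∀ c ∈ l, c ∈ U := by
  induction j generalizing κ a l with
  | zero => exact h.elim
  | succ j ih =>
    obtain ⟨l', hl | ⟨hs, hl⟩, rfl⟩ := mem_partAssign_succ.1 h
    · obtain ⟨U, h₀, h₁, h₂, h₃⟩ := ih (by omega) ha hl
      exact ⟨U, h₀, h₁, h₂, List.forall_mem_cons.2 ⟨h₁ (hrow j (by omega) a ha), h₃⟩⟩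
    · have hU : ∃ U ⊆ X, U.card ≤ κ - size a ∧ ∀ c ∈ l', c ∈ U := by
        cases j with
        | zero => rw [Set.mem_singleton_iff.1 hl]; exact ⟨∅, by simp, by simp, by simp⟩
        | succ j =>
          obtain ⟨b, hb, hlb⟩ := hl
          obtain ⟨U, h₀, -, h₂, h₃⟩ := ih (by omega) hb hlb
          exact ⟨U, h₀, h₂, h₃⟩
      obtain ⟨U, h₀, h₂, h₃⟩ := hU
      refine ⟨sets a ∪ U, Finset.union_subset (hX a ha) h₀, Finset.subset_union_left, ?_,
        List.forall_mem_cons.2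
        ⟨Finset.mem_union_left _ (hrow j (by omega) a ha),
          fun c hc => Finset.mem_union_right _ (h₃ c hc)⟩⟩
      have := Finset.card_union_le (sets a) U
      have := hcard a ha
      omega

theorem exists_superset_of_mem_allAssign {sets : ℕ → Finset ℕ} {X : Finset ℕ}
    {n κ : ℕ} (hX : ∀ a < N, sets a ⊆ X)
    (hcard : ∀ a < N, (sets a).card ≤ size a) (hrow : ∀ v < n, ∀ a < N, row v a ∈ sets a)
    {l : List ℕ} (h : l ∈ allAssign row size N n κ) :
    ∃ U ⊆ X, U.card ≤ κ ∧ ∀ c ∈ l, c ∈ U := by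
  cases n with
  | zero => rw [Set.mem_singleton_iff.1 h]; exact ⟨∅, by simp, by simp, by simp⟩
  | succ n =>
    obtain ⟨b, hb, hl⟩ := h
    obtain ⟨U, h₀, -, h₂, h₃⟩ := exists_superset_of_mem_partAssign hX hcard hrow le_rfl hb hl
    exact ⟨U, h₀, h₂, h₃⟩

/-- Completeness. By convexity the item of the next voter is either that of the present voter or one
never used before; in the second case its size splits off from the sum over distinct items, which is
exactly what the recursion charges. -/
theorem prefixList_mem_partAssign {n : ℕ} {b item : ℕ → ℕ} (hitem : ∀ v < n, item v < N)
    (hb : ∀ v < n, row v (item v) = b v)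
    (hconv : ∀ u v w, u < v → v < w → w < n → item u = item w → item v = item u)
    {j κ : ℕ} (hj : j < n) (hκ : ∑ a ∈ (Finset.range (j + 1)).image item, size a ≤ κ) :
    prefixList b (j + 1) ∈ partAssign row size N (j + 1) κ (item j) := by
  induction j generalizing κ with
  | zero =>
    refine mem_partAssign_succ.2 ⟨[], Or.inr ⟨?_, rfl⟩, ?_⟩
    · simpa using hκ
    · rw [hb 0 hj]; rfl
  | succ j ih =>
    refine mem_partAssign_succ.2 ⟨prefixList b (j + 1), ?_, by rw [hb _ hj]; rfl⟩
    rw [Finset.range_add_one, Finset.image_insert] at hκ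
    by_cases he : item (j + 1) = item j
    · left
      rw [Finset.insert_eq_of_mem (Finset.mem_image.2 ⟨j, by simp, he.symm⟩)] at hκ
      rw [he]
      exact ih (by omega) hκ
    · right
      have hnot : item (j + 1) ∉ (Finset.range (j + 1)).image item := by
        intro hmem
        obtain ⟨u, hu, hue⟩ := Finset.mem_image.1 hmem
        rw [Finset.mem_range] at hu
        rcases Nat.lt_succ_iff_lt_or_eq.1 hu with hu | rfl
        · exact he (by rw [hconv u j (j + 1) hu (by omega) hj hue, hue])
        · exact he hue.symm
      rw [Finset.sum_insert hnot] at hκ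
      exact ⟨by omega, item j, hitem j (by omega), ih (by omega) (by omega)⟩

end

/-! ### Optimal assignments -/

/-- A family of sets of candidates with their sizes, which contains all nonempty subsets of the
sets in the partition `D`. -/
structure IsItemFamily (m : ℕ) (D : ℕ → ℕ) (N : ℕ) (sets : ℕ → Finset ℕ) (size : ℕ → ℕ) :
    Prop where
  subset : ∀ a < N, sets a ⊆ Finset.range m
  card : ∀ a < N, (sets a).card = size a
  complete : ∀ B : Finset ℕ, B ⊆ Finset.range m → B.Nonempty →
    (∀ x ∈ B, ∀ y ∈ B, D x = D y) → ∃ a < N, sets a = B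

/-- `row v a` is the best candidate for the voter `v` in the set with the number `a`. -/
def IsBestRow (n N : ℕ) (pos : ℕ → ℕ → ℕ) (sets : ℕ → Finset ℕ) (row : ℕ → ℕ → ℕ) : Prop :=
  ∀ v < n, ∀ a < N, row v a ∈ sets a ∧ ∀ c ∈ sets a, pos v (row v a) ≤ pos v c

namespace Election

variable {m n t : ℕ}

/-- Positions as a function of the numbers of voter and candidate. -/
def posNat (E : Election m n) (v c : ℕ) : ℕ :=
  if h : v < n ∧ c < m then E.pos ⟨v, h.1⟩ ⟨c, h.2⟩ else 0

@[simp] theorem posNat_fin (E : Election m n) (v : Fin n) (c : Fin m) :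
    E.posNat v c = E.pos v c := by
  simp [posNat]

theorem pos_injective (E : Election m n) (v : Fin n) : Function.Injective (E.pos v) := by
  intro a b h
  exact (E.place v).injective (Fin.ext (Nat.succ_injective h))

theorem pos_le (E : Election m n) (v : Fin n) (c : Fin m) : E.pos v c ≤ m :=
  (E.place v c).isLt

theorem one_le_pos (E : Election m n) (v : Fin n) (c : Fin m) : 1 ≤ E.pos v c :=
  Nat.le_add_left _ _

theorem prefers_of_not (E : Election m n) {v : Fin n} {a b : Fin m} (hab : a ≠ b)
    (h : ¬ E.Prefers v a b) : E.Prefers v b a :=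
  lt_of_le_of_ne (not_lt.1 h) fun he => hab (E.pos_injective v he).symm

/-- One comparison decides between two clone blocks: if another pair were ordered the other way,
some member of one block would lie between two members of the other. -/
theorem WitnessesWidth.contractedPrefers {E : Election m n} {D : Fin m → Fin t} {w : ℕ}
    (h : E.WitnessesWidth D w) {v : Fin n} {a b : Fin m} (hab : D a ≠ D b)
    (hp : E.Prefers v a b) : E.ContractedPrefers D v (D a) (D b) := by
  intro a' b' ha hb
  by_contra hn
  have hba : E.Prefers v b' a' := by
    refine E.prefers_of_not ?_ hn
    rintro rfl
    exact hab (ha.symm.trans hb)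
  by_cases h1 : E.Prefers v a' b
  · have := h.clone (D b) v b' a' b hb rfl hba h1
    exact hab (ha.symm.trans this)
  · have h2 : E.Prefers v b a' := by
      refine E.prefers_of_not ?_ h1
      rintro rfl
      exact hab ha.symm
    have := h.clone (D a) v a b a' rfl ha hp h2
    exact hab this.symm

/-- The voters whose best candidates in `S` belong to the same set of the partition are
consecutive. -/
theorem WitnessesWidth.block_convex {E : Election m n} {D : Fin m → Fin t} {w : ℕ}
    (h : E.WitnessesWidth D w) {S : Finset (Fin m)} {b : Fin n → Fin m} (hbS : ∀ v, b v ∈ S)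
    (hb : ∀ v, ∀ c ∈ S, E.pos v (b v) ≤ E.pos v c) {u v x : Fin n} (huv : u < v) (hvx : v < x)
    (hux : D (b u) = D (b x)) : D (b v) = D (b u) := by
  by_contra hne
  -- For each voter the block of the best candidate beats every other block that meets `S`. So `u`
  -- and `x` agree on the blocks of `b u` and `b v`, while `v` between them disagrees; this
  -- contradicts single-crossing whichever block the first voter prefers.
  have best : ∀ y, ∀ c ∈ S, D c ≠ D (b y) → E.ContractedPrefers D y (D (b y)) (D c) := by
    intro y c hc hcy
    refine h.contractedPrefers hcy.symm (lt_of_le_of_ne (hb y c hc) fun he => hcy ?_)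
    rw [E.pos_injective y he]
  have hu := best u (b v) (hbS v) hne
  have hv := best v (b u) (hbS u) (Ne.symm hne)
  have hx := best x (b v) (hbS v) (by rwa [← hux])
  rw [← hux] at hx
  have hasymm : ∀ y, E.ContractedPrefers D y (D (b u)) (D (b v)) →
      ¬ E.ContractedPrefers D y (D (b v)) (D (b u)) := fun y h₁ h₂ =>
    lt_asymm (h₁ (b u) (b v) rfl rfl) (h₂ (b v) (b u) rfl rfl)
  have hn : 0 < n := u.pos
  by_cases h0 : E.Prefers ⟨0, hn⟩ (b u) (b v)
  · obtain ⟨s, -, -, hs⟩ := h.singleCrossing hn _ _ (h.contractedPrefers (Ne.symm hne) h0)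
    have h₁ := (hs x).1 hx
    have h₂ : ¬ ((v : ℕ) < s) := fun h' => hasymm v ((hs v).2 h') hv
    have : (v : ℕ) < x := hvx
    omega
  · have h0' := E.prefers_of_not (fun he => hne (by rw [he])) h0
    obtain ⟨s, -, -, hs⟩ := h.singleCrossing hn _ _ (h.contractedPrefers hne h0')
    have h₁ := (hs v).1 hv
    have h₂ : ¬ ((u : ℕ) < s) := fun h' => hasymm u hu ((hs u).2 h')
    have : (u : ℕ) < v := huv
    omega

/-- The competitor sends each voter to the best candidate in the range of `Ψ`, with the traces of
this range on the blocks as items. -/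
theorem WitnessesWidth.exists_mem_allAssign {E : Election m n} {D : Fin m → Fin t} {w : ℕ}
    (h : E.WitnessesWidth D w) {α : ℕ → ℕ → ℕ} (hα : IsDissatisfactionFamily α)
    (ℓ : Aggregation) {N : ℕ} {sets : ℕ → Finset ℕ} {size : ℕ → ℕ} {row : ℕ → ℕ → ℕ}
    (hI : IsItemFamily m (RAM.table fun c => (D c : ℕ)) N sets size)
    (hrow : IsBestRow n N E.posNat sets row) {k : ℕ} {Ψ : Fin n → Fin m}
    (hΨ : IsCCAssignment k Ψ) :
    ∃ l ∈ allAssign row size N n k,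
      listCost ℓ (fun v c => α m (E.posNat v c)) l ≤ E.dissatisfaction α ℓ Ψ := by
  rcases Nat.eq_zero_or_pos n with rfl | hn
  · exact ⟨[], rfl, Nat.zero_le _⟩
  set S := Finset.univ.image Ψ with hS
  have hΨS : ∀ v, Ψ v ∈ S := fun v => Finset.mem_image_of_mem _ (Finset.mem_univ v)
  have hex : ∀ v, ∃ c ∈ S, ∀ c' ∈ S, E.pos v c ≤ E.pos v c' := fun v =>
    Finset.exists_min_image S (E.pos v) ⟨Ψ v, hΨS v⟩
  choose b hbS hb using hex
  let blk : Fin t → Finset (Fin m) := fun i => S.filter fun c => D c = i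
  let blkN : Fin t → Finset ℕ := fun i => (blk i).map Fin.valEmbedding
  have hblk : ∀ v, ∃ a < N, sets a = blkN (D (b v)) := by
    intro v
    refine hI.complete _ ?_ ⟨b v, ?_⟩ ?_
    · intro c hc
      obtain ⟨c', -, rfl⟩ := Finset.mem_map.1 hc
      exact Finset.mem_range.2 c'.isLt
    · exact Finset.mem_map.2 ⟨b v, Finset.mem_filter.2 ⟨hbS v, rfl⟩, rfl⟩
    · intro x hx y hy
      obtain ⟨x', hx', rfl⟩ := Finset.mem_map.1 hx
      obtain ⟨y', hy', rfl⟩ := Finset.mem_map.1 hy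
      simp [RAM.table, (Finset.mem_filter.1 hx').2, (Finset.mem_filter.1 hy').2]
  have hblk' : ∀ i : Fin t, ∃ a, (∃ v, D (b v) = i) → a < N ∧ sets a = blkN i := by
    intro i
    by_cases hv : ∃ v, D (b v) = i
    · obtain ⟨v, rfl⟩ := hv
      obtain ⟨a, ha⟩ := hblk v
      exact ⟨a, fun _ => ha⟩
    · exact ⟨0, fun h => absurd h hv⟩
  choose it hit using hblk'
  let bN : ℕ → ℕ := fun v => if hv : v < n then b ⟨v, hv⟩ else 0
  let item : ℕ → ℕ := fun v => if hv : v < n then it (D (b ⟨v, hv⟩)) else 0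
  have hitem : ∀ v : Fin n, item v = it (D (b v)) := fun v => by simp [item]
  have hbN : ∀ v : Fin n, bN v = b v := fun v => by simp [bN]
  have hsets : ∀ v : Fin n, item v < N ∧ sets (item v) = blkN (D (b v)) := fun v => by
    rw [hitem]; exact hit _ ⟨v, rfl⟩
  have hinj : ∀ u v : Fin n, item u = item v → D (b u) = D (b v) := by
    intro u v he
    have hmem : (b u : ℕ) ∈ blkN (D (b v)) := by
      rw [← (hsets v).2, ← he, (hsets u).2]
      exact Finset.mem_map.2 ⟨b u, Finset.mem_filter.2 ⟨hbS u, rfl⟩, rfl⟩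
    obtain ⟨c, hc, hce⟩ := Finset.mem_map.1 hmem
    have : c = b u := Fin.ext hce
    rw [← this]
    exact (Finset.mem_filter.1 hc).2
  obtain ⟨n, rfl⟩ : ∃ n', n = n' + 1 := ⟨n - 1, by omega⟩
  refine ⟨prefixList bN (n + 1), ⟨item n, (hsets (Fin.last n)).1, ?_⟩, ?_⟩
  · refine prefixList_mem_partAssign (n := n + 1) (fun v hv => (hsets ⟨v, hv⟩).1) ?_ ?_
      (Nat.lt_succ_self n) ?_
    -- The best candidate in `S` lies in its own trace, so it is also the best there; injectivity of
    -- positions identifies it with the entry of `row`.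
    · intro v hv
      obtain ⟨h₁, h₂⟩ := hrow v hv (item v) (hsets ⟨v, hv⟩).1
      rw [(hsets ⟨v, hv⟩).2] at h₁ h₂
      obtain ⟨c, hc, hce⟩ := Finset.mem_map.1 h₁
      have hbm : (b ⟨v, hv⟩ : ℕ) ∈ blkN (D (b ⟨v, hv⟩)) :=
        Finset.mem_map.2 ⟨b ⟨v, hv⟩, Finset.mem_filter.2 ⟨hbS _, rfl⟩, rfl⟩
      have hle := h₂ _ hbm
      change (c : ℕ) = _ at hce
      rw [← hce] at hle ⊢
      have e1 := E.posNat_fin ⟨v, hv⟩ c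
      have e2 := E.posNat_fin ⟨v, hv⟩ (b ⟨v, hv⟩)
      simp only at e1 e2
      rw [e1, e2] at hle
      have hge := hb ⟨v, hv⟩ c (Finset.mem_filter.1 hc).1
      rw [E.pos_injective _ (le_antisymm hle hge)]
      exact (hbN ⟨v, hv⟩).symm
    · intro u v x huv hvx hx he
      have := h.block_convex hbS hb (u := ⟨u, by omega⟩) (v := ⟨v, by omega⟩) (x := ⟨x, hx⟩)
        huv hvx (hinj ⟨u, by omega⟩ ⟨x, hx⟩ he)
      have h₁ := hitem ⟨u, by omega⟩
      have h₂ := hitem ⟨v, by omega⟩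
      simp only at h₁ h₂
      rw [h₁, h₂, this]
    · set A := (Finset.range (n + 1)).image item with hA
      have hAmem : ∀ a ∈ A, ∃ v : Fin (n + 1), item v = a := by
        intro a ha
        obtain ⟨v, hv, rfl⟩ := Finset.mem_image.1 ha
        exact ⟨⟨v, Finset.mem_range.1 hv⟩, rfl⟩
      -- Distinct items come from distinct blocks, so the sizes add up to the cardinality of a union
      -- inside `S`.
      have hdis : (A : Set ℕ).PairwiseDisjoint sets := by
        intro a ha a' ha' hne
        obtain ⟨u, rfl⟩ := hAmem a ha
        obtain ⟨v, rfl⟩ := hAmem a' ha'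
        rw [Function.onFun, (hsets u).2, (hsets v).2, Finset.disjoint_left]
        intro c hc hc'
        obtain ⟨d, hd, rfl⟩ := Finset.mem_map.1 hc
        obtain ⟨d', hd', he⟩ := Finset.mem_map.1 hc'
        obtain rfl : d' = d := Fin.ext he
        refine hne ?_
        rw [hitem, hitem, ← (Finset.mem_filter.1 hd).2, ← (Finset.mem_filter.1 hd').2]
      calc ∑ a ∈ A, size a = ∑ a ∈ A, (sets a).card := by
            refine Finset.sum_congr rfl fun a ha => ?_
            obtain ⟨u, rfl⟩ := hAmem a ha
            rw [hI.card _ (hsets u).1]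
        _ = (A.biUnion sets).card := (Finset.card_biUnion hdis).symm
        _ ≤ (S.map Fin.valEmbedding).card := by
            refine Finset.card_le_card fun c hc => ?_
            obtain ⟨a, ha, hca⟩ := Finset.mem_biUnion.1 hc
            obtain ⟨u, rfl⟩ := hAmem a ha
            rw [(hsets u).2] at hca
            obtain ⟨d, hd, rfl⟩ := Finset.mem_map.1 hca
            exact Finset.mem_map.2 ⟨d, (Finset.mem_filter.1 hd).1, rfl⟩
        _ = S.card := Finset.card_map _
        _ ≤ k := hΨ
  · rw [listCost_prefixList]
    refine ℓ.value_mono fun v => ?_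
    rw [hbN, E.posNat_fin]
    exact hα.mono _ _ _ (E.one_le_pos _ _) (hb v _ (hΨS v)) (E.pos_le _ _)

/-- A cheapest assignment in the dynamic program is optimal. -/
theorem WitnessesWidth.exists_isOptimalCC {E : Election m n} {D : Fin m → Fin t} {w : ℕ}
    (h : E.WitnessesWidth D w) {α : ℕ → ℕ → ℕ} (hα : IsDissatisfactionFamily α)
    (ℓ : Aggregation) {N : ℕ} {sets : ℕ → Finset ℕ} {size : ℕ → ℕ} {row : ℕ → ℕ → ℕ}
    (hI : IsItemFamily m (RAM.table fun c => (D c : ℕ)) N sets size)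
    (hrow : IsBestRow n N E.posNat sets row) {k : ℕ} {l : List ℕ}
    (hl : l ∈ allAssign row size N n k)
    (hmin : ∀ l' ∈ allAssign row size N n k, listCost ℓ (fun v c => α m (E.posNat v c)) l ≤
      listCost ℓ (fun v c => α m (E.posNat v c)) l') :
    ∃ Φ : Fin n → Fin m, E.IsOptimalCC α ℓ k Φ ∧
      ∀ f, l = prefixList f n → ∀ v : Fin n, f v = (Φ v : ℕ) := by
  obtain ⟨U, hUm, hU, hlU⟩ := exists_superset_of_mem_allAssign hI.subset
    (fun a ha => (hI.card a ha).le) (fun v hv a ha => (hrow v hv a ha).1) hl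
  obtain ⟨f, hf⟩ := exists_eq_prefixList l
  rw [length_of_mem_allAssign hl] at hf
  have hfm : ∀ v < n, f v < m := fun v hv =>
    Finset.mem_range.1 (hUm (hlU _ (hf ▸ mem_prefixList hv)))
  let Φ : Fin n → Fin m := fun v => ⟨f v, hfm v v.isLt⟩
  have hcost : E.dissatisfaction α ℓ Φ = listCost ℓ (fun v c => α m (E.posNat v c)) l := by
    rw [hf, listCost_prefixList, dissatisfaction]
    congr 1
    funext v
    rw [← E.posNat_fin]
  refine ⟨Φ, ⟨?_, fun Ψ hΨ => ?_⟩, fun g hg v => ?_⟩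
  · refine le_trans ?_ hU
    rw [← Finset.card_map Fin.valEmbedding]
    refine Finset.card_le_card fun c hc => ?_
    obtain ⟨d, hd, rfl⟩ := Finset.mem_map.1 hc
    obtain ⟨v, -, rfl⟩ := Finset.mem_image.1 hd
    exact hlU _ (hf ▸ mem_prefixList v.isLt)
  · obtain ⟨l', hl', hle⟩ := h.exists_mem_allAssign hα ℓ hI hrow hΨ
    rw [hcost]
    exact (hmin l' hl').trans hle
  -- A list determines the function it enumerates below its length, so any `g` enumerating `l`
  -- agrees with `f` on the voters.
  · have : ∀ (j : ℕ), prefixList g j = prefixList f j → ∀ v < j, g v = f v := by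
      intro j
      induction j with
      | zero => intro _ v hv; omega
      | succ j ih =>
        intro he v hv
        obtain ⟨h₁, h₂⟩ := List.cons.inj he
        rcases Nat.lt_succ_iff_lt_or_eq.1 hv with hv | rfl
        · exact ih h₂ v hv
        · exact h₁
    exact this n (hg.symm.trans hf) v v.isLt

end Election

/-! ### The tree of candidate sets -/

/-- A tree of sets of candidates: the root `0` is the empty set, and the set with the number
`a > 0` consists of `cand a` and of the set with the number `par a < a`. -/
structure IsSetTree (D : ℕ → ℕ) (N : ℕ) (par cand size : ℕ → ℕ) (sets : ℕ → Finset ℕ) :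
    Prop where
  pos : 0 < N
  par_zero : par 0 = 0
  cand_zero : cand 0 = 0
  root : sets 0 = ∅
  par_lt : ∀ a < N, 0 < a → par a < a
  sets_eq : ∀ a < N, 0 < a → sets a = insert (cand a) (sets (par a))
  size_eq : ∀ a < N, size a = (sets a).card
  inj : ∀ a < N, ∀ b < N, sets a = sets b → a = b
  block : ∀ a < N, ∀ x ∈ sets a, D x = D (cand a)

namespace IsSetTree

variable {D : ℕ → ℕ} {N : ℕ} {par cand size : ℕ → ℕ} {sets : ℕ → Finset ℕ}

theorem cand_mem (h : IsSetTree D N par cand size sets) {a : ℕ} (ha : a < N) (h0 : 0 < a) :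
    cand a ∈ sets a := by
  rw [h.sets_eq a ha h0]; exact Finset.mem_insert_self _ _

/-- The root belongs to no block and accepts any candidate; any other set accepts only candidates of
its block. The hypothesis `hnew` keeps the numbering injective, which the count of the sets relies
on. -/
theorem push (h : IsSetTree D N par cand size sets) {a c : ℕ} (ha : a < N) (hc : c ∉ sets a)
    (hac : a = 0 ∨ D (cand a) = D c) (hnew : ∀ b < N, sets b ≠ insert c (sets a)) :
    IsSetTree D (N + 1) (Function.update par N a) (Function.update cand N c)
      (Function.update size N (size a + 1)) (Function.update sets N (insert c (sets a))) where
  pos := Nat.succ_pos _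
  par_zero := by rw [Function.update_of_ne h.pos.ne]; exact h.par_zero
  cand_zero := by rw [Function.update_of_ne h.pos.ne]; exact h.cand_zero
  root := by rw [Function.update_of_ne h.pos.ne]; exact h.root
  par_lt b hb h0 := by
    rcases Nat.lt_succ_iff_lt_or_eq.1 hb with hb | rfl
    · rw [Function.update_of_ne hb.ne]; exact h.par_lt b hb h0
    · rwa [Function.update_self]
  sets_eq b hb h0 := by
    rcases Nat.lt_succ_iff_lt_or_eq.1 hb with hb | rfl
    · have := h.par_lt b hb h0
      rw [Function.update_of_ne hb.ne, Function.update_of_ne hb.ne, Function.update_of_ne hb.ne,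
        Function.update_of_ne (by omega), h.sets_eq b hb h0]
    · rw [Function.update_self, Function.update_self, Function.update_self,
        Function.update_of_ne ha.ne]
  size_eq b hb := by
    rcases Nat.lt_succ_iff_lt_or_eq.1 hb with hb | rfl
    · rw [Function.update_of_ne hb.ne, Function.update_of_ne hb.ne, h.size_eq b hb]
    · rw [Function.update_self, Function.update_self, Finset.card_insert_of_notMem hc,
        h.size_eq a ha]
  inj b hb b' hb' he := by
    rcases Nat.lt_succ_iff_lt_or_eq.1 hb with hb | rfl
    · rw [Function.update_of_ne hb.ne] at he
      rcases Nat.lt_succ_iff_lt_or_eq.1 hb' with hb' | rfl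
      · rw [Function.update_of_ne hb'.ne] at he
        exact h.inj b hb b' hb' he
      · rw [Function.update_self] at he
        exact absurd he (hnew b hb)
    · rcases Nat.lt_succ_iff_lt_or_eq.1 hb' with hb' | rfl
      · rw [Function.update_self, Function.update_of_ne hb'.ne] at he
        exact absurd he.symm (hnew b' hb')
      · rfl
  block b hb x hx := by
    rcases Nat.lt_succ_iff_lt_or_eq.1 hb with hb | rfl
    · rw [Function.update_of_ne hb.ne] at hx ⊢
      exact h.block b hb x hx
    · rw [Function.update_self] at hx ⊢
      rcases Finset.mem_insert.1 hx with rfl | hx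
      · rfl
      · rcases hac with rfl | hac
        · rw [h.root] at hx; simp at hx
        · rw [h.block a ha x hx, hac]

end IsSetTree

/-- The tree of all sets of candidates `x < c` from the same set of the partition. -/
structure IsFullSetTree (D : ℕ → ℕ) (c N : ℕ) (par cand size : ℕ → ℕ) (sets : ℕ → Finset ℕ) :
    Prop extends IsSetTree D N par cand size sets where
  lt : ∀ a < N, ∀ x ∈ sets a, x < c
  full : ∀ B : Finset ℕ, (∀ x ∈ B, x < c) → (∀ x ∈ B, ∀ y ∈ B, D x = D y) →
    ∃ a < N, sets a = B

/-- The tree while the candidate `c` is being added to the sets with the numbers below `M`, where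
the numbers below `i` are done. -/
structure IsPartialSetTree (D : ℕ → ℕ) (c M i N : ℕ) (par cand size : ℕ → ℕ)
    (sets : ℕ → Finset ℕ) : Prop extends IsSetTree D N par cand size sets where
  le : M ≤ N
  lt : ∀ a < M, ∀ x ∈ sets a, x < c
  full : ∀ B : Finset ℕ, (∀ x ∈ B, x < c) → (∀ x ∈ B, ∀ y ∈ B, D x = D y) →
    ∃ a < M, sets a = B
  new : ∀ b < N, M ≤ b → ∃ a < i, sets b = insert c (sets a)
  done : ∀ a < i, a = 0 ∨ D (cand a) = D c → ∃ b < N, sets b = insert c (sets a)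

theorem isFullSetTree_zero (D : ℕ → ℕ) :
    IsFullSetTree D 0 1 (fun _ => 0) (fun _ => 0) (fun _ => 0) (fun _ => ∅) where
  pos := one_pos
  par_zero := rfl
  cand_zero := rfl
  root := rfl
  par_lt a ha h0 := by omega
  sets_eq a ha h0 := by omega
  size_eq a ha := rfl
  inj a ha b hb _ := by omega
  block a ha x hx := by simp at hx
  lt a ha x hx := by simp at hx
  full B hB _ := ⟨0, one_pos, by
    symm
    exact Finset.eq_empty_of_forall_notMem fun x hx => absurd (hB x hx) (Nat.not_lt_zero _)⟩

section

variable {D : ℕ → ℕ} {c M i N : ℕ} {par cand size : ℕ → ℕ} {sets : ℕ → Finset ℕ}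

theorem IsFullSetTree.start (h : IsFullSetTree D c N par cand size sets) :
    IsPartialSetTree D c N 0 N par cand size sets :=
  { h.toIsSetTree with
    le := le_rfl
    lt := h.lt
    full := h.full
    new := fun b hb hb' => by omega
    done := fun a ha => by omega }

theorem IsPartialSetTree.finish (h : IsPartialSetTree D c M M N par cand size sets) :
    IsFullSetTree D (c + 1) N par cand size sets :=
  { h.toIsSetTree with
    lt := fun b hb x hx => by
      by_cases hbM : b < M
      · have := h.lt b hbM x hx; omega
      · obtain ⟨a, ha, he⟩ := h.new b hb (not_lt.1 hbM)
        rw [he] at hx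
        rcases Finset.mem_insert.1 hx with rfl | hx
        · omega
        · have := h.lt a ha x hx; omega
    full := fun B hB hBD => by
      by_cases hc : c ∈ B
      · obtain ⟨a, ha, he⟩ := h.full (B.erase c) (fun x hx => by
            have := hB x (Finset.mem_of_mem_erase hx)
            have := Finset.ne_of_mem_erase hx
            omega) fun x hx y hy =>
              hBD x (Finset.mem_of_mem_erase hx) y (Finset.mem_of_mem_erase hy)
        -- If `B` without `c` is not the root, its last added candidate lies in `B`, hence in the
        -- block of `c`, so this set has been extended by `c`.
        obtain ⟨b, hb, he'⟩ := h.done a ha (by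
          rcases Nat.eq_zero_or_pos a with h0 | h0
          · exact Or.inl h0
          · right
            have hmem := h.cand_mem (ha.trans_le h.le) h0
            rw [he] at hmem
            exact hBD _ (Finset.mem_of_mem_erase hmem) _ hc)
        exact ⟨b, hb, by rw [he', he, Finset.insert_erase hc]⟩
      · obtain ⟨a, ha, he⟩ := h.full B (fun x hx => by
          have := hB x hx
          have : x ≠ c := by rintro rfl; exact hc hx
          omega) hBD
        exact ⟨a, ha.trans_le h.le, he⟩ }

theorem IsPartialSetTree.skip (h : IsPartialSetTree D c M i N par cand size sets)
    (hi : ¬ (i = 0 ∨ D (cand i) = D c)) :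
    IsPartialSetTree D c M (i + 1) N par cand size sets :=
  { h.toIsSetTree with
    le := h.le
    lt := h.lt
    full := h.full
    new := fun b hb hb' =>
      let ⟨a, ha, he⟩ := h.new b hb hb'
      ⟨a, by omega, he⟩
    done := fun a ha hD => by
      rcases Nat.lt_succ_iff_lt_or_eq.1 ha with ha | rfl
      · exact h.done a ha hD
      · exact absurd hD hi }

theorem IsPartialSetTree.add (h : IsPartialSetTree D c M i N par cand size sets) (hiM : i < M)
    (hi : i = 0 ∨ D (cand i) = D c) :
    IsPartialSetTree D c M (i + 1) (N + 1) (Function.update par N i) (Function.update cand N c)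
      (Function.update size N (size i + 1)) (Function.update sets N (insert c (sets i))) := by
  have hle := h.le
  have hc : ∀ a < M, c ∉ sets a := fun a ha hc => lt_irrefl _ (h.lt a ha c hc)
  -- The old sets lack `c`. Each new one extends some set before `i`, and removing `c` recovers that
  -- set, which differs from `sets i` by injectivity.
  have hnew : ∀ b < N, sets b ≠ insert c (sets i) := by
    intro b hb he
    by_cases hbM : b < M
    · exact hc b hbM (he ▸ Finset.mem_insert_self _ _)
    · obtain ⟨a, ha, he'⟩ := h.new b hb (not_lt.1 hbM)
      rw [he'] at he
      have : sets a = sets i := by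
        rw [← Finset.erase_insert (hc a (by omega)), he, Finset.erase_insert (hc i hiM)]
      have := h.inj a (by omega) i (by omega) this
      omega
  have hold : ∀ b < N, Function.update sets N (insert c (sets i)) b = sets b := fun b hb =>
    Function.update_of_ne hb.ne _ _
  exact { h.toIsSetTree.push (by omega) (hc i hiM) hi hnew with
    le := by omega
    lt := fun a ha => by rw [hold a (by omega)]; exact h.lt a ha
    full := fun B hB hBD =>
      let ⟨a, ha, he⟩ := h.full B hB hBD
      ⟨a, ha, by rw [hold a (by omega), he]⟩
    new := fun b hb hb' => by
      rcases Nat.lt_succ_iff_lt_or_eq.1 hb with hb | rfl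
      · obtain ⟨a, ha, he⟩ := h.new b hb hb'
        exact ⟨a, by omega, by rw [hold b hb, hold a (by omega), he]⟩
      · exact ⟨i, by omega, by rw [Function.update_self, hold i (by omega)]⟩
    done := fun a ha hD => by
      rw [hold a (by omega)]
      rw [Function.update_of_ne (by omega)] at hD
      rcases Nat.lt_succ_iff_lt_or_eq.1 ha with ha | rfl
      · obtain ⟨b, hb, he⟩ := h.done a ha hD
        exact ⟨b, by omega, by rw [hold b hb, he]⟩
      · exact ⟨N, by omega, Function.update_self _ _ _⟩ }

/-- Items must be nonempty to offer a candidate, so the root is reinterpreted as `{0}` with size 1.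
Loops can then run over all numbers from 0; a second copy of `{0}` does no harm, as items need not
be distinct. -/
theorem IsFullSetTree.isItemFamily (h : IsFullSetTree D c N par cand size sets) (hc : 0 < c) :
    IsItemFamily c D N (Function.update sets 0 {0}) (Function.update size 0 1) where
  subset a ha := by
    rcases Nat.eq_zero_or_pos a with rfl | h0
    · simpa using hc
    · rw [Function.update_of_ne h0.ne']
      exact fun x hx => Finset.mem_range.2 (h.lt a ha x hx)
  card a ha := by
    rcases Nat.eq_zero_or_pos a with rfl | h0
    · simp
    · rw [Function.update_of_ne h0.ne', Function.update_of_ne h0.ne', h.size_eq a ha]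
  complete B hB hne hBD := by
    obtain ⟨a, ha, rfl⟩ := h.full B (fun x hx => Finset.mem_range.1 (hB hx)) hBD
    have h0 : a ≠ 0 := by
      rintro rfl
      rw [h.root] at hne
      simp at hne
    exact ⟨a, ha, Function.update_of_ne h0 _ _⟩

end

/-- The sets are distinct and each is a subset of a block of at most `w` elements; the root is
counted in the block of candidate 0. Allowing any `c ≤ m` bounds the tree also while it is still
growing. -/
theorem IsFullSetTree.card_le {m t w : ℕ} {D : Fin m → Fin t} {c N : ℕ}
    {par cand size : ℕ → ℕ} {sets : ℕ → Finset ℕ} (hm : 0 < m) (hcm : c ≤ m)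
    (h : IsFullSetTree (RAM.table fun c => (D c : ℕ)) c N par cand size sets)
    (hw : ∀ i : Fin t, (Finset.univ.filter fun c => D c = i).card ≤ w) : N ≤ t * 2 ^ w := by
  let blk : Fin t → Finset ℕ := fun i =>
    (Finset.univ.filter fun c => D c = i).map Fin.valEmbedding
  have hsub : (Finset.range N).image sets ⊆
      Finset.univ.biUnion fun i => (blk i).powerset := by
    intro B hB
    obtain ⟨a, ha, rfl⟩ := Finset.mem_image.1 hB
    rw [Finset.mem_range] at ha
    have hcand : cand a < m := by
      rcases Nat.eq_zero_or_pos a with rfl | h0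
      · rwa [h.cand_zero]
      · exact (h.lt a ha _ (h.cand_mem ha h0)).trans_le hcm
    refine Finset.mem_biUnion.2 ⟨D ⟨cand a, hcand⟩, Finset.mem_univ _,
      Finset.mem_powerset.2 fun x hx => ?_⟩
    have hxm := (h.lt a ha x hx).trans_le hcm
    have hD := h.block a ha x hx
    simp only [RAM.table, hxm, hcand, dif_pos] at hD
    exact Finset.mem_map.2 ⟨⟨x, hxm⟩, Finset.mem_filter.2 ⟨Finset.mem_univ _, Fin.ext hD⟩, rfl⟩
  have hcard := Finset.card_le_card hsub
  rw [Finset.card_image_of_injOn fun a ha b hb he =>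
    h.inj a (Finset.mem_range.1 ha) b (Finset.mem_range.1 hb) he, Finset.card_range] at hcard
  refine hcard.trans (Finset.card_biUnion_le.trans ?_)
  calc ∑ i, ((blk i).powerset).card ≤ ∑ _i : Fin t, 2 ^ w := by
        refine Finset.sum_le_sum fun i _ => ?_
        rw [Finset.card_powerset, Finset.card_map]
        exact Nat.pow_le_pow_right two_pos (hw i)
    _ = t * 2 ^ w := by simp

/-! ### Best candidates along the tree -/

/-- `x` is an element of `U` with the least value of `p`. -/
def IsBest (p : ℕ → ℕ) (U : Finset ℕ) (x : ℕ) : Prop := x ∈ U ∧ ∀ c ∈ U, p x ≤ p c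

theorem IsBest.insert {p : ℕ → ℕ} {U : Finset ℕ} {x y : ℕ} (h : IsBest p U y) :
    IsBest p (insert x U) (if p x < p y then x else y) := by
  split_ifs with hxy
  · refine ⟨Finset.mem_insert_self _ _, fun c hc => ?_⟩
    rcases Finset.mem_insert.1 hc with rfl | hc
    · exact le_rfl
    · exact hxy.le.trans (h.2 c hc)
  · refine ⟨Finset.mem_insert_of_mem h.1, fun c hc => ?_⟩
    rcases Finset.mem_insert.1 hc with rfl | hc
    · exact not_lt.1 hxy
    · exact h.2 c hc

theorem isBest_singleton (p : ℕ → ℕ) (x : ℕ) : IsBest p {x} x :=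
  ⟨Finset.mem_singleton_self x, fun c hc => by rw [Finset.mem_singleton.1 hc]⟩

/-- The best element of a set in the tree, from the best element of its parent. -/
theorem IsSetTree.isBest {D : ℕ → ℕ} {N : ℕ} {par cand size : ℕ → ℕ} {sets : ℕ → Finset ℕ}
    (h : IsSetTree D N par cand size sets) {p : ℕ → ℕ} {row : ℕ → ℕ} {a : ℕ}
    (ha : a < N) (hrow : ∀ b < a, IsBest p (Function.update sets 0 {0} b) (row b)) :
    IsBest p (Function.update sets 0 {0} a)
      (if par a = 0 ∨ p (cand a) < p (row (par a)) then cand a else row (par a)) := by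
  rcases Nat.eq_zero_or_pos a with rfl | h0
  · simp only [Function.update_self, h.par_zero, true_or, if_true, h.cand_zero]
    exact isBest_singleton p 0
  · rw [Function.update_of_ne h0.ne', h.sets_eq a ha h0]
    by_cases hp : par a = 0
    · simp only [hp, true_or, if_true, h.root, insert_empty_eq]
      exact isBest_singleton p _
    · have := hrow (par a) (h.par_lt a ha h0)
      rw [Function.update_of_ne hp] at this
      simpa only [hp, false_or] using this.insert

/-! ### Cheapest assignments in the memory -/

/-- The list `l` is stored as a linked list that starts in the node `h`; all nodes are
below `p`. -/
def IsLinkedList (p : ℕ) (val next : ℕ → ℕ) : ℕ → List ℕ → Prop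
  | _, [] => True
  | h, c :: l => h < p ∧ val h = c ∧ IsLinkedList p val next (next h) l

/-- A write to the fresh node `p` cannot disturb a list whose nodes are all below `p`. Lists may
therefore share tails, and nothing is ever copied. -/
theorem IsLinkedList.push {p : ℕ} {val next : ℕ → ℕ} {h : ℕ} {l : List ℕ}
    (H : IsLinkedList p val next h l) (c g : ℕ) :
    IsLinkedList (p + 1) (Function.update val p c) (Function.update next p g) h l := by
  induction l generalizing h with
  | nil => trivial
  | cons d l ih =>
    obtain ⟨h₁, h₂, h₃⟩ := H
    refine ⟨by omega, by rwa [Function.update_of_ne h₁.ne], ?_⟩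
    rw [Function.update_of_ne h₁.ne]
    exact ih h₃

/-- If `x = 0`, the set `S` is empty.  Otherwise the least cost of a member of `S` is `x - 1`, and
`h` points to a member of that cost. -/
def IsCell (p : ℕ) (val next : ℕ → ℕ) (cost : List ℕ → ℕ) (S : Set (List ℕ)) (x h : ℕ) : Prop :=
  (x = 0 ∧ S = ∅) ∨
    ∃ l ∈ S, x = cost l + 1 ∧ IsLinkedList p val next h l ∧ ∀ l' ∈ S, cost l ≤ cost l'

namespace IsCell

variable {p : ℕ} {val next : ℕ → ℕ} {cost : List ℕ → ℕ} {S S' : Set (List ℕ)} {x h y g : ℕ}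

theorem empty (h : ℕ) : IsCell p val next cost ∅ 0 h := Or.inl ⟨rfl, rfl⟩

theorem push (H : IsCell p val next cost S x h) (c g : ℕ) :
    IsCell (p + 1) (Function.update val p c) (Function.update next p g) cost S x h := by
  rcases H with H | ⟨l, h₁, h₂, h₃, h₄⟩
  · exact Or.inl H
  · exact Or.inr ⟨l, h₁, h₂, h₃.push c g, h₄⟩

/-- The shift by one separates cost 0 from emptiness, so a minimum over a union must treat the value
0 as infinite. -/
theorem union_left (H : IsCell p val next cost S x h) (H' : IsCell p val next cost S' y g)
    (hyx : y = 0 ∨ x ≠ 0 ∧ x ≤ y) : IsCell p val next cost (S ∪ S') x h := by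
  rcases H' with ⟨rfl, rfl⟩ | ⟨l', h₁', rfl, h₃', h₄'⟩
  · rwa [Set.union_empty]
  · rcases H with ⟨rfl, rfl⟩ | ⟨l, h₁, rfl, h₃, h₄⟩
    · simp at hyx
    · refine Or.inr ⟨l, Or.inl h₁, rfl, h₃, ?_⟩
      rintro l'' (hl | hl)
      · exact h₄ _ hl
      · have := h₄' _ hl; omega

theorem union_right (H : IsCell p val next cost S x h) (H' : IsCell p val next cost S' y g)
    (hyx : y ≠ 0) (hx : x = 0 ∨ y < x) : IsCell p val next cost (S ∪ S') y g := by
  rw [Set.union_comm]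
  refine H'.union_left H ?_
  omega

/-- All lists in the set are prolonged by a new voter. -/
theorem cons {ℓ : Aggregation} {pen : ℕ → ℕ → ℕ} {j : ℕ}
    (H : IsCell p val next (listCost ℓ pen) S x h) (hj : ∀ l ∈ S, l.length = j) (hx : x ≠ 0)
    (c : ℕ) :
    IsCell (p + 1) (Function.update val p c) (Function.update next p h) (listCost ℓ pen)
      {l | ∃ l' ∈ S, l = c :: l'} (ℓ.op (x - 1) (pen j c) + 1) p := by
  rcases H with ⟨rfl, rfl⟩ | ⟨l, h₁, rfl, h₃, h₄⟩
  · exact absurd rfl hx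
  · refine Or.inr ⟨c :: l, ⟨l, h₁, rfl⟩, ?_, ⟨by omega, by simp, ?_⟩, ?_⟩
    · simp [listCost, hj l h₁]
    · rw [Function.update_self]; exact h₃.push c h
    · rintro _ ⟨l', hl', rfl⟩
      -- All members have length `j`, so the new voter adds the same dissatisfaction to each, and
      -- monotonicity of `op` keeps the cheapest one cheapest.
      rw [listCost, listCost, hj l h₁, hj l' hl']
      exact ℓ.op_le_op (h₄ l' hl') le_rfl

theorem cons_zero (H : IsCell p val next cost S 0 h) (c g : ℕ) :
    IsCell p val next cost {l | ∃ l' ∈ S, l = c :: l'} 0 g := by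
  rcases H with ⟨-, rfl⟩ | ⟨l, -, h₂, -⟩
  · left; simp
  · omega

end IsCell

/-! ### The program

The registers of the program are used as follows.

* `0`, `1`, `2`: the input `m`, `n`, `k`
* `4`: the number `N` of sets in the tree
* `5`, `6`, `7`: a candidate, the previous number of sets, the number of a set
* `8`, `9`: a voter `j`, and `j * m`
* `10`, `11`, `12`: a number `κ ≤ k` of candidates, `k + 1`, and `κ * N`
* `13`, `14`: `j * (k + 1)` and `(j + 1) * (k + 1)`
* `15`, `16`, `17`, `19`: intermediate values
* `20`: the next free node for linked lists

The arrays are used as follows.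

* `0`, `1`, `2`: the input and the output
* `3`, `4`, `5`: parent, added candidate and size of the sets in the tree
* `6`, `7`: the best candidate of the present voter in a set, and the dissatisfaction with it
* `8`, `9`: value and pointer of the cells for a number of candidates and a last set
* `10`, `11`: value and pointer of the cells for a number of voters and of candidates
* `12`, `13`: content and successor of the nodes -/

namespace RAM

/-! ### Building the tree -/

/-- Add the set that arises from the set `7` of the tree and the candidate `5`, if possible. -/
def growBody : Prog :=
  .ite (.add (.sub (.lit 1) (.reg 7)) (.sub (.lit 1) (.add
      (.sub (.cell 1 (.cell 4 (.reg 7))) (.cell 1 (.reg 5)))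
      (.sub (.cell 1 (.reg 5)) (.cell 1 (.cell 4 (.reg 7)))))))
    (.seq (.setCell 3 (.reg 4) (.reg 7))
      (.seq (.setCell 4 (.reg 4) (.reg 5))
        (.seq (.setCell 5 (.reg 4) (.add (.cell 5 (.reg 7)) (.lit 1)))
          (.setReg 4 (.add (.reg 4) (.lit 1))))))
    .skip

/-- Add all sets that contain the candidate `5`. -/
def growStep : Prog := .seq (.setReg 6 (.reg 4)) (.for 7 6 growBody)

/-- Build the tree, and change the size of the set `0` to `1`. -/
def growTree : Prog :=
  .seq (.setReg 4 (.lit 1)) (.seq (.for 5 0 growStep) (.setCell 5 (.lit 0) (.lit 1)))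

theorem runs_growBody {D : ℕ → ℕ} {c M i N : ℕ} {sets : ℕ → Finset ℕ} {s : Store}
    (hD : s.arr 1 = D) (hc : s.reg 5 = c) (hi : s.reg 7 = i) (hN : s.reg 4 = N) (hiM : i < M)
    (h : IsPartialSetTree D c M i N (s.arr 3) (s.arr 4) (s.arr 5) sets) :
    Runs growBody s growBody.bound fun s' => ∃ sets,
      IsPartialSetTree D c M (i + 1) (s'.reg 4) (s'.arr 3) (s'.arr 4) (s'.arr 5) sets := by
  refine Runs.straight rfl ?_
  -- The test of the program is a sum of truncated differences: `1 - i` detects the root, and 1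
  -- minus the absolute difference of the block numbers detects equal blocks.
  by_cases hit : i = 0 ∨ D (s.arr 4 i) = D c
  · refine ⟨Function.update sets N (insert c (sets i)), ?_⟩
    have := h.add hiM hit
    have hne : i ≠ N := by have := h.le; omega
    simp only [growBody, Prog.run, Expr.eval, hD, hc, hi, hN]
    rw [if_neg (by omega)]
    simpa [Store.setCell_arr, hi, hc, hN, hne] using this
  · refine ⟨sets, ?_⟩
    have := h.skip hit
    simp only [growBody, Prog.run, Expr.eval, hD, hc, hi, hN]
    rw [if_pos (by omega)]
    simpa [hN] using this

/-- Register 6 freezes the old number of sets, so the loop does not visit the sets that it creates.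
-/
theorem runs_growStep {D : ℕ → ℕ} {c N : ℕ} {sets : ℕ → Finset ℕ} {s : Store}
    (hD : s.arr 1 = D) (hc : s.reg 5 = c) (hN : s.reg 4 = N)
    (h : IsFullSetTree D c N (s.arr 3) (s.arr 4) (s.arr 5) sets) :
    Runs growStep s (2 + (N * (growBody.bound + 8) + 8)) fun s' => ∃ sets,
      IsFullSetTree D (c + 1) (s'.reg 4) (s'.arr 3) (s'.arr 4) (s'.arr 5) sets := by
  refine Runs.seq (R := fun s' => s' = s.setReg 6 N) (Runs.straight rfl ?_) ?_
  · simp [Prog.run, Expr.eval, hN]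
  rintro _ - rfl
  refine (Runs.for (B := N) (T := growBody.bound) (fun i s' => ∃ sets,
    IsPartialSetTree D c N i (s'.reg 4) (s'.arr 3) (s'.arr 4) (s'.arr 5) sets)
    (by decide) (by decide) (by simp) ?_ ?_).mono le_rfl ?_
  · refine ⟨sets, ?_⟩
    simpa [hN] using h.start
  · rintro i hi s' hag hi' ⟨sets, hs⟩
    refine (runs_growBody ?_ ?_ hi' rfl hi hs).mono le_rfl ?_
    · rw [hag.2 1 (by decide)]; simpa using hD
    · rw [hag.1 5 (by decide)]; simpa using hc
    · rintro s'' ⟨sets, hs⟩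
      exact ⟨sets, by simpa using hs⟩
  · rintro s' ⟨sets, hs⟩
    exact ⟨sets, hs.finish⟩

theorem runs_growTree {m t w : ℕ} {D : Fin m → Fin t} (hm : 0 < m)
    (hw : ∀ i : Fin t, (Finset.univ.filter fun c => D c = i).card ≤ w) {s : Store}
    (hm' : s.reg 0 = m) (hD : s.arr 1 = table fun c => (D c : ℕ)) (h3 : s.arr 3 = fun _ => 0)
    (h4 : s.arr 4 = fun _ => 0) (h5 : s.arr 5 = fun _ => 0) :
    Runs growTree s
      (2 + ((m * (2 + (t * 2 ^ w * (growBody.bound + 8) + 8) + 8) + 8) + 3)) fun s' =>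
      ∃ sets size, s'.reg 4 ≤ t * 2 ^ w ∧ s'.arr 5 = Function.update size 0 1 ∧
        IsFullSetTree (table fun c => (D c : ℕ)) m (s'.reg 4) (s'.arr 3) (s'.arr 4) size
          sets := by
  refine Runs.seq (R := fun s' => s' = s.setReg 4 1) (Runs.straight rfl rfl) ?_
  rintro _ - rfl
  refine Runs.seq (R := fun s' => ∃ sets, IsFullSetTree (table fun c => (D c : ℕ)) m
    (s'.reg 4) (s'.arr 3) (s'.arr 4) (s'.arr 5) sets) ?_ ?_
  · refine Runs.for (B := m) (fun c s' => ∃ sets, IsFullSetTree (table fun c => (D c : ℕ)) c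
      (s'.reg 4) (s'.arr 3) (s'.arr 4) (s'.arr 5) sets)
      (by decide) (by decide) (by simpa using hm') ?_ ?_
    · refine ⟨fun _ => ∅, ?_⟩
      simpa [h3, h4, h5] using isFullSetTree_zero _
    · rintro c hc s' hag hc' ⟨sets, hs⟩
      refine (runs_growStep ?_ hc' rfl hs).mono ?_ ?_
      · rw [hag.2 1 (by decide)]; simpa using hD
      -- The length of the inner loop is the current size of the tree, bounded at every stage by the
      -- same quantity.
      · have := hs.card_le hm hc.le hw
        gcongr
      · rintro s'' ⟨sets, hs⟩
        exact ⟨sets, by simpa using hs⟩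
  · rintro s₁ - ⟨sets, hs⟩
    refine Runs.straight rfl ⟨sets, s₁.arr 5, ?_⟩
    have := hs.card_le hm le_rfl hw
    simpa [Prog.run, Expr.eval, Store.setCell_arr] using ⟨this, hs⟩

/-! ### Best candidates of one voter -/

/-- Find the best candidate in the set `7`. -/
def rowBody (p : Prog) : Prog :=
  .seq (.ite (.add (.sub (.lit 1) (.cell 3 (.reg 7)))
      (.sub (.cell 0 (.add (.reg 9) (.cell 6 (.cell 3 (.reg 7)))))
        (.cell 0 (.add (.reg 9) (.cell 4 (.reg 7))))))
      (.setCell 6 (.reg 7) (.cell 4 (.reg 7)))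
      (.setCell 6 (.reg 7) (.cell 6 (.cell 3 (.reg 7)))))
    (.seq (.call 19 p [.reg 0, .cell 0 (.add (.reg 9) (.cell 6 (.reg 7)))])
      (.setCell 7 (.reg 7) (.reg 19)))

/-- Find the best candidates of a voter in all sets of the tree. -/
def rows (p : Prog) : Prog := .for 7 4 (rowBody p)

@[simp] theorem rowBody_wregs (p : Prog) : (rowBody p).wregs = [19] := rfl
@[simp] theorem rowBody_warrs (p : Prog) : (rowBody p).warrs = [6, 6, 7] := rfl
@[simp] theorem rows_wregs (p : Prog) : (rows p).wregs = [7, 19, 7] := rfl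
@[simp] theorem rows_warrs (p : Prog) : (rows p).warrs = [6, 6, 7] := rfl

/-- The program `p` computes `f m i` for `i ∈ [m]` within `T` steps. -/
def Computes (p : Prog) (f : ℕ → ℕ) (m T : ℕ) : Prop :=
  ∀ i, 1 ≤ i → i ≤ m → Runs p (Store.ofArgs [m, i]) T fun s => s.reg 0 = f i

/-- Parents have smaller numbers than their children, so the entry of the parent is ready when it is
read. The invariant speaks only of entries below `i`, since the others may be left over from the
previous voter. -/
theorem runs_rows {p : Prog} {f : ℕ → ℕ} {m T : ℕ} (hp : Computes p f m T) {D : ℕ → ℕ} {N : ℕ}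
    {size : ℕ → ℕ} {sets : ℕ → Finset ℕ} {s : Store} {pos : ℕ → ℕ}
    (h : IsSetTree D N (s.arr 3) (s.arr 4) size sets) (hm : s.reg 0 = m) (hN : s.reg 4 = N)
    (hpos : ∀ c < m, s.arr 0 (s.reg 9 + c) = pos c) (h1 : ∀ c < m, 1 ≤ pos c)
    (hle : ∀ c < m, pos c ≤ m)
    (hsub : ∀ a < N, Function.update sets 0 {0} a ⊆ Finset.range m) :
    Runs (rows p) s (N * (T + 50 + 8) + 8) fun s' => ∀ a < N,
      IsBest pos (Function.update sets 0 {0} a) (s'.arr 6 a) ∧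
        s'.arr 7 a = f (pos (s'.arr 6 a)) := by
  refine Runs.for (B := N) (fun i s' => ∀ a < i,
    IsBest pos (Function.update sets 0 {0} a) (s'.arr 6 a) ∧ s'.arr 7 a = f (pos (s'.arr 6 a)))
    (by simp) (by simp) hN (fun a ha => by omega) ?_
  intro i hi s' hag hi' hI
  have a0 : s'.arr 0 = s.arr 0 := hag.2 0 (by simp)
  have a3 : s'.arr 3 = s.arr 3 := hag.2 3 (by simp)
  have a4 : s'.arr 4 = s.arr 4 := hag.2 4 (by simp)
  have r9 : s'.reg 9 = s.reg 9 := hag.1 9 (by simp)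
  have r0 : s'.reg 0 = m := (hag.1 0 (by simp)).trans hm
  have hlt : ∀ a < N, ∀ x, IsBest pos (Function.update sets 0 {0} a) x → x < m := fun a ha x hx =>
    Finset.mem_range.1 (hsub a ha hx.1)
  have hbest := h.isBest hi (fun b hb => (hI b hb).1)
  have hcand : s.arr 4 i < m := by
    refine Finset.mem_range.1 (hsub i hi ?_)
    rcases Nat.eq_zero_or_pos i with rfl | h0
    · simp [h.cand_zero]
    · rw [Function.update_of_ne h0.ne']; exact h.cand_mem hi h0
  set x := if s.arr 3 i = 0 ∨ pos (s.arr 4 i) < pos (s'.arr 6 (s.arr 3 i)) then s.arr 4 i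
    else s'.arr 6 (s.arr 3 i) with hx
  have hxm := hlt i hi x hbest
  -- The summand `1 - s.arr 3 i` alone settles the case of the root as parent. In the other case it
  -- vanishes, and the truncated difference is positive exactly when the added candidate is better
  -- than the parent's best.
  have hcond : (1 - s.arr 3 i + (s.arr 0 (s.reg 9 + s'.arr 6 (s.arr 3 i)) -
      s.arr 0 (s.reg 9 + s.arr 4 i)) = 0) ↔
      ¬ (s.arr 3 i = 0 ∨ pos (s.arr 4 i) < pos (s'.arr 6 (s.arr 3 i))) := by
    by_cases h0 : s.arr 3 i = 0
    · simp [h0]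
    · have hi0 : 0 < i := by
        rcases Nat.eq_zero_or_pos i with rfl | hi0
        · exact absurd h.par_zero h0
        · exact hi0
      have hpi := h.par_lt i hi hi0
      rw [hpos _ hcand, hpos _ (hlt _ (by omega) _ (hI _ hpi).1)]
      omega
  refine (Runs.seq (T₁ := 30) (T₂ := T + 20) (R := fun s₁ => s₁ = s'.setCell 6 i x) ?_ ?_).mono
    (by omega) (fun s'' hs'' => hs'')
  · refine (Runs.straight rfl ?_).mono (by decide) fun s'' hs'' => hs''
    simp only [Prog.run, Expr.eval, a0, a3, a4, r9, hi', hcond, hx]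
    split_ifs <;> rfl
  · rintro s₁ - rfl
    refine (Runs.seq (T₁ := T + 8) (T₂ := 3)
      (R := fun s₂ => s₂ = (s'.setCell 6 i x).setReg 19 (f (pos x))) ?_ ?_).mono (by omega)
      (fun s'' hs'' => hs'')
    · refine (Runs.call 19 (T := T) ?_).mono ?_ fun s'' hs'' => hs''
      · have := hp (pos x) (h1 _ hxm) (hle _ hxm)
        simp only [List.map, Expr.eval, Store.setCell_arr, Store.setCell_reg, hi', r0, r9, a0]
        simp only [Function.update_self, if_true, Nat.reduceEqDiff, if_false, hpos _ hxm]
        refine this.mono le_rfl fun s₃ h₃ => ?_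
        rw [h₃]
      · simp [Expr.cost]; omega
    · rintro s₂ - rfl
      refine Runs.straight rfl ?_
      intro a ha
      simp only [Prog.run, Expr.eval, Store.setCell_arr, Store.setReg_arr, Store.setReg_reg,
        Store.setCell_reg, hi']
      simp only [Nat.reduceEqDiff, if_true, if_false]
      rcases Nat.lt_succ_iff_lt_or_eq.1 ha with ha | rfl
      · rw [Function.update_of_ne ha.ne, Function.update_of_ne ha.ne]
        exact hI a ha
      · rw [Function.update_self, Function.update_self]
        exact ⟨hbest, rfl⟩

end RAM

/-! ### Updating one cell of the dynamic program -/

namespace RAM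

/-- `IsCell` for the linked lists in the memory `s`. -/
def HasCell (s : Store) (cost : List ℕ → ℕ) (S : Set (List ℕ)) (x h : ℕ) : Prop :=
  IsCell (s.reg 20) (s.arr 12) (s.arr 13) cost S x h

/-- All cells in the memory `s` are also cells in `s'`. -/
def KeepsCells (s s' : Store) : Prop :=
  ∀ cost S x h, HasCell s cost S x h → HasCell s' cost S x h

theorem keepsCells_of_eq {s s' : Store} (h20 : s'.reg 20 = s.reg 20)
    (h12 : s'.arr 12 = s.arr 12) (h13 : s'.arr 13 = s.arr 13) : KeepsCells s s' := by
  intro cost S x h H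
  rwa [HasCell, h20, h12, h13]

theorem KeepsCells.trans {s s₁ s₂ : Store} (h : KeepsCells s s₁) (h' : KeepsCells s₁ s₂) :
    KeepsCells s s₂ := fun cost S x g H => h' _ _ _ _ (h cost S x g H)

/-- Choose the better one of two ways to assign the voters before the present one. -/
def pick : Prog :=
  .seq (.setReg 15 (.cell 8 (.add (.reg 12) (.reg 7))))
    (.seq (.setReg 16 (.cell 9 (.add (.reg 12) (.reg 7))))
      (.ite (.sub (.add (.reg 10) (.lit 1)) (.cell 5 (.reg 7)))
        (.seq (.setReg 17 (.cell 10 (.add (.reg 13) (.sub (.reg 10) (.cell 5 (.reg 7))))))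
          (.ite (.reg 17)
            (.ite (.add (.sub (.lit 1) (.reg 15)) (.sub (.reg 15) (.reg 17)))
              (.seq (.setReg 15 (.reg 17))
                (.setReg 16 (.cell 11 (.add (.reg 13) (.sub (.reg 10) (.cell 5 (.reg 7)))))))
              .skip) .skip)) .skip))

/-- `S` continues the last interval and `S'` opens a new one. The guard `κ + 1 - size` is nonzero
exactly when the item fits the budget; only then is the index `κ - size` meaningful. -/
theorem runs_pick {s : Store} {cost : List ℕ → ℕ} {S S' : Set (List ℕ)}
    (h : HasCell s cost S (s.arr 8 (s.reg 12 + s.reg 7)) (s.arr 9 (s.reg 12 + s.reg 7)))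
    (h' : s.arr 5 (s.reg 7) ≤ s.reg 10 → HasCell s cost S'
      (s.arr 10 (s.reg 13 + (s.reg 10 - s.arr 5 (s.reg 7))))
      (s.arr 11 (s.reg 13 + (s.reg 10 - s.arr 5 (s.reg 7))))) :
    Runs pick s pick.bound fun s' => HasCell s' cost
      (S ∪ {l | s.arr 5 (s.reg 7) ≤ s.reg 10 ∧ l ∈ S'}) (s'.reg 15) (s'.reg 16) := by
  refine Runs.straight rfl ?_
  simp only [pick, Prog.run, Expr.eval, Store.setReg_reg, Store.setReg_arr, Nat.reduceEqDiff,
    if_true, if_false]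
  by_cases hs : s.arr 5 (s.reg 7) ≤ s.reg 10
  · rw [if_neg (by omega)]
    have h'' := h' hs
    simp only [hs, true_and, Set.ofPred_mem_eq]
    split_ifs with h1 h2
    · simpa [HasCell] using h.union_left h'' (Or.inl h1)
    · simpa [HasCell] using h.union_left h'' (by omega)
    · simpa [HasCell] using h.union_right h'' h1 (by omega)
  · rw [if_pos (by omega)]
    simpa [HasCell, hs] using h

/-- The expression for the value of a cell when the voter gets the set `7`. -/
def opExpr : Aggregation → Expr
  | .l1 => .add (.reg 15) (.cell 7 (.reg 7))
  | .linf => .add (.reg 15) (.sub (.add (.cell 7 (.reg 7)) (.lit 1)) (.reg 15))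

/-- Register 15 holds the cost plus one. For the maximum, `x + (y - x)` with truncated subtraction
equals `max x y`. -/
theorem eval_opExpr (ℓ : Aggregation) {s : Store} (h : s.reg 15 ≠ 0) :
    (opExpr ℓ).eval s = ℓ.op (s.reg 15 - 1) (s.arr 7 (s.reg 7)) + 1 := by
  cases ℓ <;> simp only [opExpr, Expr.eval, Aggregation.op] <;> omega

/-- Assign the best candidate in the set `7` to the present voter. -/
def extend (ℓ : Aggregation) : Prog :=
  .ite (.reg 15)
    (.seq (.setCell 12 (.reg 20) (.cell 6 (.reg 7)))
      (.seq (.setCell 13 (.reg 20) (.reg 16))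
        (.seq (.setReg 15 (opExpr ℓ))
          (.seq (.setReg 16 (.reg 20)) (.setReg 20 (.add (.reg 20) (.lit 1)))))))
    .skip

/-- Only the fresh node is written, so all cells of the memory survive, for any cost function and
any set of lists; this is why `KeepsCells` quantifies over both. -/
theorem runs_extend {ℓ : Aggregation} {s : Store} {pen : ℕ → ℕ → ℕ} {S : Set (List ℕ)} {j : ℕ}
    (h : HasCell s (listCost ℓ pen) S (s.reg 15) (s.reg 16)) (hj : ∀ l ∈ S, l.length = j)
    (hpen : s.arr 7 (s.reg 7) = pen j (s.arr 6 (s.reg 7))) :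
    Runs (extend ℓ) s (extend ℓ).bound fun s' => KeepsCells s s' ∧
      HasCell s' (listCost ℓ pen) {l | ∃ l' ∈ S, l = s.arr 6 (s.reg 7) :: l'}
        (s'.reg 15) (s'.reg 16) := by
  refine Runs.straight rfl ?_
  by_cases h0 : s.reg 15 = 0
  · simp only [extend, Prog.run, Expr.eval, h0, if_true]
    rw [h0] at h
    exact ⟨fun _ _ _ _ H => H, h.cons_zero _ (s.reg 16)⟩
  · simp only [extend, Prog.run, Expr.eval, h0, if_false]
    rw [eval_opExpr _ (by simpa using h0)]
    refine ⟨fun cost S x g H => ?_, ?_⟩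
    · simpa [HasCell, Store.setCell_arr] using H.push (s.arr 6 (s.reg 7)) (s.reg 16)
    · simpa [HasCell, Store.setCell_arr, hpen] using h.cons hj h0 (s.arr 6 (s.reg 7))

/-- Store a cell, and update the best cell for a number of candidates. -/
def keepBest : Prog :=
  .seq (.setCell 8 (.add (.reg 12) (.reg 7)) (.reg 15))
    (.seq (.setCell 9 (.add (.reg 12) (.reg 7)) (.reg 16))
      (.ite (.reg 15)
        (.ite (.add (.sub (.lit 1) (.cell 10 (.add (.reg 14) (.reg 10))))
            (.sub (.cell 10 (.add (.reg 14) (.reg 10))) (.reg 15)))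
          (.seq (.setCell 10 (.add (.reg 14) (.reg 10)) (.reg 15))
            (.setCell 11 (.add (.reg 14) (.reg 10)) (.reg 16)))
          .skip) .skip))

theorem runs_keepBest {s : Store} {cost : List ℕ → ℕ} {S S' : Set (List ℕ)}
    (h : HasCell s cost S (s.reg 15) (s.reg 16))
    (h' : HasCell s cost S' (s.arr 10 (s.reg 14 + s.reg 10)) (s.arr 11 (s.reg 14 + s.reg 10))) :
    Runs keepBest s keepBest.bound fun s' =>
      (∀ e, e ≠ s.reg 12 + s.reg 7 → s'.arr 8 e = s.arr 8 e ∧ s'.arr 9 e = s.arr 9 e) ∧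
      (∀ e, e ≠ s.reg 14 + s.reg 10 → s'.arr 10 e = s.arr 10 e ∧ s'.arr 11 e = s.arr 11 e) ∧
      HasCell s' cost S (s'.arr 8 (s.reg 12 + s.reg 7)) (s'.arr 9 (s.reg 12 + s.reg 7)) ∧
      HasCell s' cost (S' ∪ S) (s'.arr 10 (s.reg 14 + s.reg 10))
        (s'.arr 11 (s.reg 14 + s.reg 10)) := by
  refine Runs.straight rfl ?_
  simp only [keepBest, Prog.run, Expr.eval, Store.setCell_reg, Store.setCell_arr,
    Nat.reduceEqDiff, if_false]
  split_ifs with h1 h2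
  · refine ⟨?_, ?_, ?_, ?_⟩
    · intro e he; simp [Store.setCell_arr, Function.update_of_ne he]
    · intro e he; simp [Store.setCell_arr]
    · simpa [HasCell, Store.setCell_arr] using h
    · simpa [HasCell, Store.setCell_arr] using h'.union_left h (Or.inl h1)
  · refine ⟨?_, ?_, ?_, ?_⟩
    · intro e he; simp [Store.setCell_arr, Function.update_of_ne he]
    · intro e he; simp [Store.setCell_arr]
    · simpa [HasCell, Store.setCell_arr] using h
    · simpa [HasCell, Store.setCell_arr] using h'.union_left h (by omega)
  · refine ⟨?_, ?_, ?_, ?_⟩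
    · intro e he; simp [Store.setCell_arr, Function.update_of_ne he]
    · intro e he; simp [Store.setCell_arr, Function.update_of_ne he]
    · simpa [HasCell, Store.setCell_arr] using h
    · simpa [HasCell, Store.setCell_arr] using h'.union_right h h1 (by omega)

/-- The treatment of a voter, a number of candidates, and a set. -/
def cellBody (ℓ : Aggregation) : Prog := .seq pick (.seq (extend ℓ) keepBest)

@[simp] theorem cellBody_wregs (ℓ : Aggregation) :
    (cellBody ℓ).wregs = [15, 16, 17, 15, 16, 15, 16, 20] := rfl
@[simp] theorem cellBody_warrs (ℓ : Aggregation) :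
    (cellBody ℓ).warrs = [12, 13, 8, 9, 10, 11] := rfl
@[simp] theorem extend_wregs (ℓ : Aggregation) : (extend ℓ).wregs = [15, 16, 20] := rfl
@[simp] theorem extend_warrs (ℓ : Aggregation) : (extend ℓ).warrs = [12, 13] := rfl

/-- A bound on the number of steps of `cellBody`. -/
def cellTime (ℓ : Aggregation) : ℕ := pick.bound + ((extend ℓ).bound + keepBest.bound)

/-- One step of the recursion for `partAssign`, done in place: the cell in the arrays 8 and 9 goes
from `S` to `T`, and `T` is merged into the running minimum for the budget. -/
theorem runs_cellBody {ℓ : Aggregation} {s : Store} {pen : ℕ → ℕ → ℕ} {S S' S'' : Set (List ℕ)}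
    {j : ℕ}
    (h : HasCell s (listCost ℓ pen) S (s.arr 8 (s.reg 12 + s.reg 7))
      (s.arr 9 (s.reg 12 + s.reg 7)))
    (h' : s.arr 5 (s.reg 7) ≤ s.reg 10 → HasCell s (listCost ℓ pen) S'
      (s.arr 10 (s.reg 13 + (s.reg 10 - s.arr 5 (s.reg 7))))
      (s.arr 11 (s.reg 13 + (s.reg 10 - s.arr 5 (s.reg 7)))))
    (h'' : HasCell s (listCost ℓ pen) S'' (s.arr 10 (s.reg 14 + s.reg 10))
      (s.arr 11 (s.reg 14 + s.reg 10)))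
    (hj : ∀ l ∈ S, l.length = j) (hj' : ∀ l ∈ S', l.length = j)
    (hpen : s.arr 7 (s.reg 7) = pen j (s.arr 6 (s.reg 7))) {T : Set (List ℕ)}
    (hT : T = {l | ∃ l' ∈ S ∪ {l | s.arr 5 (s.reg 7) ≤ s.reg 10 ∧ l ∈ S'},
      l = s.arr 6 (s.reg 7) :: l'}) :
    Runs (cellBody ℓ) s (cellTime ℓ) fun s' => KeepsCells s s' ∧
      (∀ e, e ≠ s.reg 12 + s.reg 7 → s'.arr 8 e = s.arr 8 e ∧ s'.arr 9 e = s.arr 9 e) ∧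
      (∀ e, e ≠ s.reg 14 + s.reg 10 → s'.arr 10 e = s.arr 10 e ∧ s'.arr 11 e = s.arr 11 e) ∧
      HasCell s' (listCost ℓ pen) T (s'.arr 8 (s.reg 12 + s.reg 7))
        (s'.arr 9 (s.reg 12 + s.reg 7)) ∧
      HasCell s' (listCost ℓ pen) (S'' ∪ T) (s'.arr 10 (s.reg 14 + s.reg 10))
        (s'.arr 11 (s.reg 14 + s.reg 10)) := by
  refine Runs.seq (runs_pick h h') fun s₁ hag₁ h₁ => ?_
  have reg₁ : ∀ x, x ∉ pick.wregs → s₁.reg x = s.reg x := hag₁.1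
  have arr₁ : s₁.arr = s.arr := funext fun a => hag₁.2 a (by simp [show pick.warrs = [] from rfl])
  have k₁ : KeepsCells s s₁ := keepsCells_of_eq (reg₁ 20 (by decide)) (by rw [arr₁])
    (by rw [arr₁])
  have r7 : s₁.reg 7 = s.reg 7 := reg₁ 7 (by decide)
  refine Runs.seq (runs_extend (j := j) h₁ ?_ (by rw [r7, arr₁, hpen])) ?_
  · rintro l (hl | ⟨-, hl⟩)
    · exact hj l hl
    · exact hj' l hl
  rintro s₂ hag₂ ⟨k₂, h₂⟩
  rw [r7, arr₁, ← hT] at h₂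
  have r7' : s₂.reg 7 = s.reg 7 := (hag₂.1 7 (by simp)).trans r7
  have r12 : s₂.reg 12 = s.reg 12 := (hag₂.1 12 (by simp)).trans (reg₁ 12 (by decide))
  have r14 : s₂.reg 14 = s.reg 14 := (hag₂.1 14 (by simp)).trans (reg₁ 14 (by decide))
  have r10 : s₂.reg 10 = s.reg 10 := (hag₂.1 10 (by simp)).trans (reg₁ 10 (by decide))
  have a8 : s₂.arr 8 = s.arr 8 := by rw [hag₂.2 8 (by simp), arr₁]
  have a9 : s₂.arr 9 = s.arr 9 := by rw [hag₂.2 9 (by simp), arr₁]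
  have a10 : s₂.arr 10 = s.arr 10 := by rw [hag₂.2 10 (by simp), arr₁]
  have a11 : s₂.arr 11 = s.arr 11 := by rw [hag₂.2 11 (by simp), arr₁]
  have := runs_keepBest h₂ (S' := S'') (by
    rw [r14, r10, a10, a11]
    exact (k₁.trans k₂) _ _ _ _ h'')
  rw [r12, r7', r14, r10, a8, a9, a10, a11] at this
  refine this.agree.mono le_rfl ?_
  rintro s₃ ⟨hag₃, h₃⟩
  exact ⟨(k₁.trans k₂).trans (keepsCells_of_eq (hag₃.1 20 (by decide)) (hag₃.2 12 (by decide))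
    (hag₃.2 13 (by decide))), h₃⟩

end RAM

/-! ### Filling the tables -/

namespace RAM

/-- The tables of the dynamic program when the voters before `j` are done, and for the voter `j`
the first `q` cells; there are `K` numbers of candidates. -/
structure IsTable (cost : List ℕ → ℕ) (row : ℕ → ℕ → ℕ) (size : ℕ → ℕ) (N K j q : ℕ)
    (s : Store) : Prop where
  part : ∀ κ < K, ∀ a < N, HasCell s cost
    (partAssign row size N (if κ * N + a < q then j + 1 else j) κ a)
    (s.arr 8 (κ * N + a)) (s.arr 9 (κ * N + a))
  all : ∀ κ < K, HasCell s cost (allAssign row size N j κ)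
    (s.arr 10 (j * K + κ)) (s.arr 11 (j * K + κ))

/-- The cells for the first `j + 1` voters and for less than `r` candidates are done. -/
def IsNewTable (cost : List ℕ → ℕ) (row : ℕ → ℕ → ℕ) (size : ℕ → ℕ) (N K j r : ℕ)
    (s : Store) : Prop :=
  ∀ κ < r, HasCell s cost (allAssign row size N (j + 1) κ)
    (s.arr 10 (j * K + K + κ)) (s.arr 11 (j * K + K + κ))

section

variable {cost : List ℕ → ℕ} {row : ℕ → ℕ → ℕ} {size : ℕ → ℕ} {N K j q r : ℕ} {s s' : Store}

theorem IsTable.congr (h : IsTable cost row size N K j q s) (hk : KeepsCells s s')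
    (h8 : s'.arr 8 = s.arr 8) (h9 : s'.arr 9 = s.arr 9)
    (h10 : ∀ e < j * K + K, s'.arr 10 e = s.arr 10 e)
    (h11 : ∀ e < j * K + K, s'.arr 11 e = s.arr 11 e) :
    IsTable cost row size N K j q s' where
  part κ hκ a ha := by rw [h8, h9]; exact hk _ _ _ _ (h.part κ hκ a ha)
  all κ hκ := by
    rw [h10 _ (by omega), h11 _ (by omega)]; exact hk _ _ _ _ (h.all κ hκ)

theorem IsNewTable.congr (h : IsNewTable cost row size N K j r s) (hk : KeepsCells s s')
    (h10 : ∀ e, e ≠ j * K + K + r → s'.arr 10 e = s.arr 10 e)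
    (h11 : ∀ e, e ≠ j * K + K + r → s'.arr 11 e = s.arr 11 e) :
    IsNewTable cost row size N K j r s' := fun κ hκ => by
  rw [h10 _ (by omega), h11 _ (by omega)]; exact hk _ _ _ _ (h κ hκ)

theorem IsTable.next (h : IsTable cost row size N K j (K * N) s)
    (h' : IsNewTable cost row size N K j K s) : IsTable cost row size N K (j + 1) 0 s where
  part κ hκ a ha := by
    have := h.part κ hκ a ha
    rw [if_pos] at this
    · rwa [if_neg (Nat.not_lt_zero _)]
    · calc κ * N + a < κ * N + N := by omega
        _ = (κ + 1) * N := by ring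
        _ ≤ K * N := Nat.mul_le_mul_right _ hκ
  all κ hκ := by
    have := h' κ hκ
    rwa [← Nat.succ_mul] at this

end

/-- Overwriting in place is safe: a new entry needs only the old entry with the same budget and
item, and the minima for `j` voters, which sit in a different row of the arrays 10 and 11. The
hypothesis `h0` starts the running minimum over the items at the empty set. -/
theorem runs_cells {ℓ : Aggregation} {pen row : ℕ → ℕ → ℕ} {size : ℕ → ℕ} {N K j κ : ℕ}
    {s : Store} (hN : s.reg 4 = N) (hκ : s.reg 10 = κ) (hκK : κ < K) (h12 : s.reg 12 = κ * N)
    (h13 : s.reg 13 = j * K) (h14 : s.reg 14 = j * K + K)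
    (hsize : ∀ a < N, s.arr 5 a = size a)
    (hrow : ∀ a < N, s.arr 6 a = row j a ∧ s.arr 7 a = pen j (row j a))
    (h : IsTable (listCost ℓ pen) row size N K j (κ * N) s)
    (hnew : IsNewTable (listCost ℓ pen) row size N K j κ s)
    (h0 : s.arr 10 (j * K + K + κ) = 0) :
    Runs (.for 7 4 (cellBody ℓ)) s (N * (cellTime ℓ + 8) + 8) fun s' =>
      IsTable (listCost ℓ pen) row size N K j (κ * N + N) s' ∧
      IsNewTable (listCost ℓ pen) row size N K j (κ + 1) s' := by
  refine (Runs.for (B := N) (T := cellTime ℓ) (fun a s' =>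
    IsTable (listCost ℓ pen) row size N K j (κ * N + a) s' ∧
    IsNewTable (listCost ℓ pen) row size N K j κ s' ∧
    HasCell s' (listCost ℓ pen) {l | ∃ b < a, l ∈ partAssign row size N (j + 1) κ b}
      (s'.arr 10 (j * K + K + κ)) (s'.arr 11 (j * K + K + κ)))
    (by simp) (by simp) hN ⟨?_, ?_, ?_⟩ ?_).mono le_rfl ?_
  · exact h.congr (keepsCells_of_eq (by simp) rfl rfl) rfl rfl (fun _ _ => rfl) fun _ _ => rfl
  · exact hnew.congr (keepsCells_of_eq (by simp) rfl rfl) (fun _ _ => rfl) fun _ _ => rfl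
  · left
    exact ⟨h0, by simp⟩
  · rintro a ha s₁ hag ha' ⟨ht, hn, hc⟩
    have r10 : s₁.reg 10 = κ := (hag.1 10 (by simp)).trans hκ
    have r12 : s₁.reg 12 = κ * N := (hag.1 12 (by simp)).trans h12
    have r13 : s₁.reg 13 = j * K := (hag.1 13 (by simp)).trans h13
    have r14 : s₁.reg 14 = j * K + K := (hag.1 14 (by simp)).trans h14
    have a5 : s₁.arr 5 a = size a := by rw [hag.2 5 (by simp), hsize a ha]
    have a6 : s₁.arr 6 a = row j a := by rw [hag.2 6 (by simp), (hrow a ha).1]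
    have a7 : s₁.arr 7 a = pen j (row j a) := by rw [hag.2 7 (by simp), (hrow a ha).2]
    have hpart := ht.part κ hκK a ha
    rw [if_neg (lt_irrefl _)] at hpart
    have key := runs_cellBody (ℓ := ℓ) (s := s₁) (pen := pen) (j := j)
      (S := partAssign row size N j κ a) (S' := allAssign row size N j (κ - size a))
      (S'' := {l | ∃ b < a, l ∈ partAssign row size N (j + 1) κ b})
      (T := partAssign row size N (j + 1) κ a)
    simp only [ha', r10, r12, r13, r14, a5, a6, a7] at key
    refine (key hpart (fun hs => ht.all (κ - size a) (by omega)) hc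
      (fun l hl => length_of_mem_partAssign hl) (fun l hl => length_of_mem_allAssign hl) trivial
      rfl).mono le_rfl ?_
    rintro s₂ ⟨hk, h89, h1011, hT, hU⟩
    have hk' : KeepsCells s₂ (s₂.setReg 7 (a + 1)) := keepsCells_of_eq (by simp) rfl rfl
    refine ⟨⟨fun κ' hκ' a' ha'' => ?_, fun κ' hκ' => ?_⟩, ?_, ?_⟩
    · refine hk' _ _ _ _ ?_
      rw [Store.setReg_arr]
      -- Since the items are below `N`, an index determines the budget and the item.
      by_cases he : κ' * N + a' = κ * N + a
      · have haa : a' = a := by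
          have := congrArg (· % N) he
          simpa [Nat.mod_eq_of_lt ha, Nat.mod_eq_of_lt ha''] using this
        have hκκ : κ' = κ := by
          subst haa
          exact Nat.eq_of_mul_eq_mul_right (by omega) (Nat.add_right_cancel he)
        rw [he, if_pos (by omega), hκκ, haa]
        exact hT
      · rw [(h89 _ he).1, (h89 _ he).2]
        have := hk _ _ _ _ (ht.part κ' hκ' a' ha'')
        by_cases hlt : κ' * N + a' < κ * N + a
        · rw [if_pos hlt] at this
          rwa [if_pos (by omega)]
        · rw [if_neg hlt] at this
          rwa [if_neg (by omega)]
    · refine hk' _ _ _ _ ?_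
      rw [Store.setReg_arr, (h1011 _ (by omega)).1, (h1011 _ (by omega)).2]
      exact hk _ _ _ _ (ht.all κ' hκ')
    · exact hn.congr (hk.trans hk') (fun e he => (h1011 e he).1) fun e he => (h1011 e he).2
    · refine hk' _ _ _ _ ?_
      rw [Store.setReg_arr]
      convert hU using 1
      ext l
      simp only [Nat.lt_succ_iff_lt_or_eq, Set.mem_ofPred_eq, Set.mem_union]
      constructor
      · rintro ⟨b, hb | rfl, hl⟩
        · exact Or.inl ⟨b, hb, hl⟩
        · exact Or.inr hl
      · rintro (⟨b, hb, hl⟩ | hl)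
        · exact ⟨b, Or.inl hb, hl⟩
        · exact ⟨a, Or.inr rfl, hl⟩
  · rintro s₁ ⟨ht, hn, hc⟩
    refine ⟨ht, fun κ' hκ' => ?_⟩
    rcases Nat.lt_succ_iff_lt_or_eq.1 hκ' with hκ' | rfl
    · exact hn κ' hκ'
    · exact hc

/-- Fill the cells for a number of candidates. -/
def layerStep (ℓ : Aggregation) : Prog :=
  .seq (.setCell 10 (.add (.reg 14) (.reg 10)) (.lit 0))
    (.seq (.for 7 4 (cellBody ℓ)) (.setReg 12 (.add (.reg 12) (.reg 4))))

/-- Fill the cells for a voter. -/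
def layer (ℓ : Aggregation) : Prog := .for 10 11 (layerStep ℓ)

@[simp] theorem layerStep_wregs (ℓ : Aggregation) :
    (layerStep ℓ).wregs = [7, 15, 16, 17, 15, 16, 15, 16, 20, 7, 12] := rfl
@[simp] theorem layerStep_warrs (ℓ : Aggregation) :
    (layerStep ℓ).warrs = [10, 12, 13, 8, 9, 10, 11] := rfl
@[simp] theorem layer_wregs (ℓ : Aggregation) :
    (layer ℓ).wregs = [10, 7, 15, 16, 17, 15, 16, 15, 16, 20, 7, 12, 10] := rfl
@[simp] theorem layer_warrs (ℓ : Aggregation) :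
    (layer ℓ).warrs = [10, 12, 13, 8, 9, 10, 11] := rfl

/-- A bound on the number of steps of `layer`. -/
def layerTime (ℓ : Aggregation) (N K : ℕ) : ℕ :=
  K * (5 + ((N * (cellTime ℓ + 8) + 8) + 4) + 8) + 8

theorem runs_layer {ℓ : Aggregation} {pen row : ℕ → ℕ → ℕ} {size : ℕ → ℕ} {N K j : ℕ}
    {s : Store} (hN : s.reg 4 = N) (hK : s.reg 11 = K) (h12 : s.reg 12 = 0)
    (h13 : s.reg 13 = j * K) (h14 : s.reg 14 = j * K + K)
    (hsize : ∀ a < N, s.arr 5 a = size a)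
    (hrow : ∀ a < N, s.arr 6 a = row j a ∧ s.arr 7 a = pen j (row j a))
    (h : IsTable (listCost ℓ pen) row size N K j 0 s) :
    Runs (layer ℓ) s (layerTime ℓ N K) fun s' =>
      IsTable (listCost ℓ pen) row size N K (j + 1) 0 s' := by
  refine (Runs.for (B := K) (fun κ s' => s'.reg 12 = κ * N ∧
    IsTable (listCost ℓ pen) row size N K j (κ * N) s' ∧
    IsNewTable (listCost ℓ pen) row size N K j κ s')
    (by simp) (by simp) hK ⟨?_, ?_, ?_⟩ ?_).mono le_rfl ?_
  · simpa using h12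
  · rw [Nat.zero_mul]
    exact h.congr (keepsCells_of_eq (by simp) rfl rfl) rfl rfl (fun _ _ => rfl) fun _ _ => rfl
  · intro κ hκ; omega
  · rintro κ hκ s₁ hag hκ' ⟨h12', ht, hn⟩
    have r4 : s₁.reg 4 = N := (hag.1 4 (by simp)).trans hN
    have r13 : s₁.reg 13 = j * K := (hag.1 13 (by simp)).trans h13
    have r14 : s₁.reg 14 = j * K + K := (hag.1 14 (by simp)).trans h14
    have a5 : s₁.arr 5 = s.arr 5 := hag.2 5 (by simp)
    have a6 : s₁.arr 6 = s.arr 6 := hag.2 6 (by simp)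
    have a7 : s₁.arr 7 = s.arr 7 := hag.2 7 (by simp)
    refine Runs.seq (R := fun s₂ => s₂ = s₁.setCell 10 (j * K + K + κ) 0)
      (Runs.straight rfl ?_) ?_
    · simp [Prog.run, Expr.eval, r14, hκ']
    rintro _ - rfl
    have hk₁ : KeepsCells s₁ (s₁.setCell 10 (j * K + K + κ) 0) :=
      keepsCells_of_eq rfl (by simp [Store.setCell_arr]) (by simp [Store.setCell_arr])
    refine Runs.seq (runs_cells (j := j) (κ := κ) (K := K) (pen := pen) (row := row)
      (size := size) r4 hκ' hκ h12' r13 r14 ?_ ?_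
      (ht.congr hk₁ ?_ ?_ ?_ ?_) (hn.congr hk₁ ?_ ?_) ?_) ?_
    · intro a ha
      simp [Store.setCell_arr, a5, hsize a ha]
    · intro a ha
      simp [Store.setCell_arr, a6, a7, hrow a ha]
    · simp [Store.setCell_arr]
    · simp [Store.setCell_arr]
    · intro e he
      rw [Store.setCell_arr_same, Function.update_of_ne (by omega)]
    · simp [Store.setCell_arr]
    · intro e he
      rw [Store.setCell_arr_same, Function.update_of_ne he]
    · simp [Store.setCell_arr]
    · simp
    · rintro s₂ hag₂ ⟨ht₂, hn₂⟩
      have r4' : s₂.reg 4 = N := (hag₂.1 4 (by simp)).trans r4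
      have r12' : s₂.reg 12 = κ * N := (hag₂.1 12 (by simp)).trans h12'
      refine Runs.straight rfl ?_
      have hk₂ : KeepsCells s₂ ((s₂.setReg 12 (κ * N + N)).setReg 10 (κ + 1)) :=
        keepsCells_of_eq (by simp) rfl rfl
      simp only [Prog.run, Expr.eval, r4', r12']
      refine ⟨by simp [Nat.succ_mul], ?_, ?_⟩
      · rw [Nat.succ_mul]
        exact ht₂.congr hk₂ rfl rfl (fun _ _ => rfl) fun _ _ => rfl
      · exact hn₂.congr hk₂ (fun _ _ => rfl) fun _ _ => rfl
  · rintro s₁ ⟨-, ht, hn⟩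
    exact ht.next hn

end RAM

/-- Identifies the candidates found by the machine with the abstractly chosen `row`, as positions of
one voter are injective. -/
theorem IsBest.unique {p : ℕ → ℕ} {U : Finset ℕ} {x y : ℕ} (hp : Set.InjOn p U)
    (hx : IsBest p U x) (hy : IsBest p U y) : x = y :=
  hp hx.1 hy.1 (le_antisymm (hx.2 y hy.1) (hy.2 x hx.1))

theorem IsSetTree.nonempty {D : ℕ → ℕ} {N : ℕ} {par cand size : ℕ → ℕ} {sets : ℕ → Finset ℕ}
    (h : IsSetTree D N par cand size sets) {a : ℕ} (ha : a < N) :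
    (Function.update sets 0 {0} a).Nonempty := by
  rcases Nat.eq_zero_or_pos a with rfl | h0
  · simp
  · rw [Function.update_of_ne h0.ne']
    exact ⟨_, h.cand_mem ha h0⟩

namespace Election

variable {m n : ℕ}

theorem posNat_injOn (E : Election m n) {v : ℕ} (hv : v < n) :
    Set.InjOn (E.posNat v) (Finset.range m) := by
  intro a ha b hb he
  have ha' : a < m := Finset.mem_range.1 ha
  have hb' : b < m := Finset.mem_range.1 hb
  simp only [posNat, hv, ha', hb', and_self, dif_pos] at he
  exact congrArg Fin.val (E.pos_injective _ he)

theorem one_le_posNat (E : Election m n) {v c : ℕ} (hv : v < n) (hc : c < m) :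
    1 ≤ E.posNat v c := by
  simpa [posNat, hv, hc] using E.one_le_pos _ _

theorem posNat_le (E : Election m n) {v c : ℕ} (hv : v < n) (hc : c < m) :
    E.posNat v c ≤ m := by
  simpa [posNat, hv, hc] using E.pos_le _ _

theorem inputStore_arr_zero {t : ℕ} (E : Election m n) (D : Fin m → Fin t) (k : ℕ) {v c : ℕ}
    (hv : v < n) (hc : c < m) : (inputStore E D k).arr 0 (v * m + c) = E.posNat v c := by
  have hlt : v * m + c < n * m :=
    calc v * m + c < v * m + m := by omega
      _ = (v + 1) * m := by ring
      _ ≤ n * m := Nat.mul_le_mul_right _ hv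
  have hd : (v * m + c) / m = v := by
    rw [Nat.add_comm, Nat.add_mul_div_right _ _ (by omega), Nat.div_eq_of_lt hc, Nat.zero_add]
  have hr : (v * m + c) % m = c := by
    rw [Nat.add_comm, Nat.add_mul_mod_self_right, Nat.mod_eq_of_lt hc]
  simp only [inputStore, RAM.table, hlt, dif_pos, posNat, hv, hc, and_self]
  congr 1
  · exact Fin.ext hd
  · exact Fin.ext hr

end Election

/-! ### The complete program and its correctness -/

namespace RAM

/-- The treatment of a voter. -/
def voterStep (ℓ : Aggregation) (p : Prog) : Prog :=
  .seq (rows p) (.seq (.setReg 14 (.add (.reg 13) (.reg 11))) (.seq (.setReg 12 (.lit 0))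
    (.seq (layer ℓ) (.seq (.setReg 9 (.add (.reg 9) (.reg 0))) (.setReg 13 (.reg 14))))))

/-- The treatment of all voters. -/
def voters (ℓ : Aggregation) (p : Prog) : Prog := .for 8 1 (voterStep ℓ p)

@[simp] theorem voterStep_wregs (ℓ : Aggregation) (p : Prog) : (voterStep ℓ p).wregs =
    [7, 19, 7, 14, 12, 10, 7, 15, 16, 17, 15, 16, 15, 16, 20, 7, 12, 10, 9, 13] := rfl
@[simp] theorem voterStep_warrs (ℓ : Aggregation) (p : Prog) :
    (voterStep ℓ p).warrs = [6, 6, 7, 10, 12, 13, 8, 9, 10, 11] := rfl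
@[simp] theorem voters_wregs (ℓ : Aggregation) (p : Prog) : (voters ℓ p).wregs =
    [8, 7, 19, 7, 14, 12, 10, 7, 15, 16, 17, 15, 16, 15, 16, 20, 7, 12, 10, 9, 13, 8] := rfl
@[simp] theorem voters_warrs (ℓ : Aggregation) (p : Prog) :
    (voters ℓ p).warrs = [6, 6, 7, 10, 12, 13, 8, 9, 10, 11] := rfl

/-- A bound on the number of steps of `voterStep`. -/
def voterTime (ℓ : Aggregation) (T N K : ℕ) : ℕ :=
  (N * (T + 50 + 8) + 8) + (4 + (2 + (layerTime ℓ N K + 6)))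

/-- Without multiplication the offsets `j * m` and `j * K` are kept in registers and advanced by
addition, hence they are part of the invariant. -/
theorem runs_voters {ℓ : Aggregation} {p : Prog} {f : ℕ → ℕ} {m n T N K : ℕ}
    (hp : Computes p f m T) {E : Election m n} {D : ℕ → ℕ} {size : ℕ → ℕ}
    {sets : ℕ → Finset ℕ} {s : Store} {row : ℕ → ℕ → ℕ}
    (h : IsSetTree D N (s.arr 3) (s.arr 4) size sets) (hm : s.reg 0 = m) (hn : s.reg 1 = n)
    (hN : s.reg 4 = N) (hK : s.reg 11 = K) (h9 : s.reg 9 = 0) (h13 : s.reg 13 = 0)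
    (hpos : ∀ v < n, ∀ c < m, s.arr 0 (v * m + c) = E.posNat v c)
    (hsub : ∀ a < N, Function.update sets 0 {0} a ⊆ Finset.range m)
    (hrow : IsBestRow n N E.posNat (Function.update sets 0 {0}) row)
    (ht : IsTable (listCost ℓ fun v c => f (E.posNat v c)) row (s.arr 5) N K 0 0 s) :
    Runs (voters ℓ p) s (n * (voterTime ℓ T N K + 8) + 8) fun s' => s'.reg 13 = n * K ∧
      IsTable (listCost ℓ fun v c => f (E.posNat v c)) row (s.arr 5) N K n 0 s' := by
  refine (Runs.for (B := n) (fun j s' => s'.reg 9 = j * m ∧ s'.reg 13 = j * K ∧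
    IsTable (listCost ℓ fun v c => f (E.posNat v c)) row (s.arr 5) N K j 0 s')
    (by simp) (by simp) hn ⟨?_, ?_, ?_⟩ ?_).mono le_rfl fun s' hs' => hs'.2
  · simpa using h9
  · simpa using h13
  · exact ht.congr (keepsCells_of_eq (by simp) rfl rfl) rfl rfl (fun _ _ => rfl) fun _ _ => rfl
  rintro j hj s₁ hag hj' ⟨h9₁, h13₁, ht₁⟩
  have r0 : s₁.reg 0 = m := (hag.1 0 (by simp)).trans hm
  have r4 : s₁.reg 4 = N := (hag.1 4 (by simp)).trans hN
  have r11 : s₁.reg 11 = K := (hag.1 11 (by simp)).trans hK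
  have a0 : s₁.arr 0 = s.arr 0 := hag.2 0 (by simp)
  have a3 : s₁.arr 3 = s.arr 3 := hag.2 3 (by simp)
  have a4 : s₁.arr 4 = s.arr 4 := hag.2 4 (by simp)
  have a5 : s₁.arr 5 = s.arr 5 := hag.2 5 (by simp)
  refine Runs.seq (runs_rows hp (D := D) (size := size) (sets := sets) (pos := E.posNat j)
    (by rw [a3, a4]; exact h) r0 r4 (fun c hc => by rw [h9₁, a0, hpos j hj c hc])
    (fun c hc => E.one_le_posNat hj hc) (fun c hc => E.posNat_le hj hc) hsub) ?_
  intro s₂ hag₂ hs₂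
  have hrow₂ : ∀ a < N, s₂.arr 6 a = row j a ∧ s₂.arr 7 a = f (E.posNat j (row j a)) := by
    intro a ha
    obtain ⟨h₁, h₂⟩ := hs₂ a ha
    have : s₂.arr 6 a = row j a :=
      h₁.unique ((E.posNat_injOn hj).mono (by exact_mod_cast hsub a ha)) (hrow j hj a ha)
    exact ⟨this, by rw [h₂, this]⟩
  have ht₂ := ht₁.congr (s' := s₂) (keepsCells_of_eq (hag₂.1 20 (by simp)) (hag₂.2 12 (by simp))
    (hag₂.2 13 (by simp))) (hag₂.2 8 (by simp)) (hag₂.2 9 (by simp))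
    (fun _ _ => by rw [hag₂.2 10 (by simp)]) (fun _ _ => by rw [hag₂.2 11 (by simp)])
  have r11₂ : s₂.reg 11 = K := (hag₂.1 11 (by simp)).trans r11
  have r13₂ : s₂.reg 13 = j * K := (hag₂.1 13 (by simp)).trans h13₁
  have r9₂ : s₂.reg 9 = j * m := (hag₂.1 9 (by simp)).trans h9₁
  have r4₂ : s₂.reg 4 = N := (hag₂.1 4 (by simp)).trans r4
  have r0₂ : s₂.reg 0 = m := (hag₂.1 0 (by simp)).trans r0
  have a5₂ : s₂.arr 5 = s.arr 5 := (hag₂.2 5 (by simp)).trans a5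
  refine Runs.seq (R := fun s₃ => s₃ = s₂.setReg 14 (j * K + K)) (Runs.straight rfl ?_) ?_
  · simp [Prog.run, Expr.eval, r11₂, r13₂]
  rintro _ - rfl
  refine Runs.seq (R := fun s₃ => s₃ = (s₂.setReg 14 (j * K + K)).setReg 12 0)
    (Runs.straight rfl rfl) ?_
  rintro _ - rfl
  refine Runs.seq (runs_layer (j := j) (N := N) (K := K) (row := row) (size := s.arr 5)
    (pen := fun v c => f (E.posNat v c)) (by simpa using r4₂) (by simpa using r11₂) (by simp)
    (by simpa using r13₂) (by simp) (fun a _ => by simp [a5₂]) (fun a ha => hrow₂ a ha)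
    (ht₂.congr (keepsCells_of_eq (by simp) rfl rfl) rfl rfl (fun _ _ => rfl) fun _ _ => rfl)) ?_
  intro s₃ hag₃ ht₃
  have r14₃ : s₃.reg 14 = j * K + K := (hag₃.1 14 (by simp)).trans (by simp)
  have r9₃ : s₃.reg 9 = j * m := (hag₃.1 9 (by simp)).trans (by simpa using r9₂)
  have r0₃ : s₃.reg 0 = m := (hag₃.1 0 (by simp)).trans (by simpa using r0₂)
  refine Runs.straight rfl ?_
  simp only [Prog.run, Expr.eval, r9₃, r0₃]
  refine ⟨by simp [Nat.succ_mul], by simp [Nat.succ_mul, r14₃], ?_⟩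
  exact ht₃.congr (keepsCells_of_eq (by simp) rfl rfl) rfl rfl (fun _ _ => rfl) fun _ _ => rfl

/-- Initialize the cells for no voters. -/
def initCells : Prog :=
  .seq (.setReg 11 (.add (.reg 2) (.lit 1)))
    (.seq (.setReg 9 (.lit 0)) (.seq (.setReg 13 (.lit 0))
      (.for 10 11 (.setCell 10 (.reg 10) (.lit 1)))))

theorem runs_initCells {s : Store} {k : ℕ} (hk : s.reg 2 = k) {ℓ : Aggregation}
    {pen row : ℕ → ℕ → ℕ} {size : ℕ → ℕ} {N : ℕ} (h8 : s.arr 8 = fun _ => 0) :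
    Runs initCells s (4 + (2 + (2 + ((k + 1) * (3 + 8) + 8)))) fun s' => s'.reg 11 = k + 1 ∧
      s'.reg 9 = 0 ∧ s'.reg 13 = 0 ∧ IsTable (listCost ℓ pen) row size N (k + 1) 0 0 s' := by
  refine Runs.seq (R := fun s' => s' = s.setReg 11 (k + 1)) (Runs.straight rfl ?_) ?_
  · simp [Prog.run, Expr.eval, hk]
  rintro _ - rfl
  refine Runs.seq (R := fun s' => s' = (s.setReg 11 (k + 1)).setReg 9 0)
    (Runs.straight rfl rfl) ?_
  rintro _ - rfl
  refine Runs.seq (R := fun s' => s' = ((s.setReg 11 (k + 1)).setReg 9 0).setReg 13 0)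
    (Runs.straight rfl rfl) ?_
  rintro _ - rfl
  refine (Runs.for (B := k + 1) (T := 3) (fun κ s' => ∀ κ' < κ, s'.arr 10 κ' = 1)
    (by decide) (by decide) (by simp) (fun κ' hκ' => by omega) ?_).agree.mono le_rfl ?_
  · intro κ hκ s₁ hag hκ' h₁
    refine Runs.straight rfl ?_
    intro κ' hlt
    simp only [Prog.run, Expr.eval, hκ', Store.setReg_arr, Store.setCell_arr_same]
    rcases Nat.lt_succ_iff_lt_or_eq.1 hlt with hlt | rfl
    · rw [Function.update_of_ne hlt.ne, h₁ _ hlt]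
    · rw [Function.update_self]
  · rintro s₁ ⟨hag, h₁⟩
    have r11 : s₁.reg 11 = k + 1 := (hag.1 11 (by decide)).trans (by simp)
    have r9 : s₁.reg 9 = 0 := (hag.1 9 (by decide)).trans (by simp)
    have r13 : s₁.reg 13 = 0 := (hag.1 13 (by decide)).trans (by simp)
    have a8 : s₁.arr 8 = fun _ => 0 := (hag.2 8 (by decide)).trans (by simpa using h8)
    -- With no voters there is no last item, so the zero memory is right for `partAssign`; the value
    -- 1 encodes cost 0 of the empty assignment, for every budget.
    refine ⟨r11, r9, r13, fun κ hκ a ha => ?_, fun κ hκ => ?_⟩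
    · rw [if_neg (Nat.not_lt_zero _), a8]
      exact IsCell.empty _
    · rw [Nat.zero_mul, Nat.zero_add, h₁ κ hκ]
      refine Or.inr ⟨[], rfl, rfl, trivial, ?_⟩
      rintro l' -
      exact Nat.zero_le _

/-- Write the assignment into the array `2`. -/
def output : Prog :=
  .seq (.setReg 16 (.cell 11 (.add (.reg 13) (.reg 2))))
    (.seq (.setReg 15 (.reg 1))
      (.for 8 1 (.seq (.setReg 15 (.sub (.reg 15) (.lit 1)))
        (.seq (.setCell 2 (.reg 15) (.cell 12 (.reg 16)))
          (.setReg 16 (.cell 13 (.reg 16)))))))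

/-- The lists start with the last voter, so register 15 counts downwards while the list is
traversed. -/
theorem runs_output {s : Store} {n p : ℕ} {f : ℕ → ℕ} (hn : s.reg 1 = n)
    (h : IsLinkedList p (s.arr 12) (s.arr 13) (s.arr 11 (s.reg 13 + s.reg 2))
      (prefixList f n)) :
    Runs output s (5 + (2 + (n * (11 + 8) + 8))) fun s' => ∀ v < n, s'.arr 2 v = f v := by
  refine Runs.seq (R := fun s' => s' = s.setReg 16 (s.arr 11 (s.reg 13 + s.reg 2)))
    (Runs.straight rfl rfl) ?_
  rintro _ - rfl
  refine Runs.seq (R := fun s' => s' =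
    (s.setReg 16 (s.arr 11 (s.reg 13 + s.reg 2))).setReg 15 n) (Runs.straight rfl ?_) ?_
  · simp [Prog.run, Expr.eval, hn]
  rintro _ - rfl
  refine (Runs.for (B := n) (T := 11) (fun i s' => s'.reg 15 = n - i ∧
    IsLinkedList p (s.arr 12) (s.arr 13) (s'.reg 16) (prefixList f (n - i)) ∧
    ∀ v < n, n - i ≤ v → s'.arr 2 v = f v)
    (by decide) (by decide) (by simpa using hn) ⟨by simp, by simpa using h, ?_⟩ ?_).mono
    le_rfl ?_
  · intro v hv hv'; omega
  · rintro i hi s₁ hag hi' ⟨h15, hl, ho⟩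
    have a12 : s₁.arr 12 = s.arr 12 := hag.2 12 (by decide)
    have a13 : s₁.arr 13 = s.arr 13 := hag.2 13 (by decide)
    obtain ⟨d, hd⟩ : ∃ d, n - i = d + 1 := ⟨n - i - 1, by omega⟩
    have hd' : n - (i + 1) = d := by omega
    rw [hd] at h15 hl ho
    obtain ⟨-, hl₁, hl₂⟩ := hl
    refine (Runs.straight rfl ?_).mono (by decide) fun s' hs' => hs'
    simp only [Prog.run, Expr.eval, h15, hd']
    refine ⟨by simp, by simpa [Store.setCell_arr, a13] using hl₂, ?_⟩
    intro v hv hv'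
    simp only [Store.setReg_arr, Store.setCell_arr_same, Store.setReg_reg, a12]
    simp only [if_true, Nat.reduceEqDiff, if_false, Nat.add_sub_cancel]
    rcases hv'.eq_or_lt with rfl | hlt
    · rw [Function.update_self, hl₁]
    · rw [Function.update_of_ne hlt.ne']
      exact ho v hv hlt
  · rintro s₁ ⟨-, -, ho⟩ v hv
    exact ho v hv (by omega)

/-- The program for optimal assignments. -/
def ccProg (ℓ : Aggregation) (p : Prog) : Prog :=
  .seq growTree (.seq initCells (.seq (voters ℓ p) output))

/-- A bound on the number of steps of `ccProg`, where `T` is a bound for one dissatisfaction, and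
`N` is a bound on the number of sets in the tree. -/
def ccTime (ℓ : Aggregation) (m n k T N : ℕ) : ℕ :=
  (2 + ((m * (2 + (N * (growBody.bound + 8) + 8) + 8) + 8) + 3)) +
    ((4 + (2 + (2 + ((k + 1) * (3 + 8) + 8)))) +
      ((n * (voterTime ℓ T N (k + 1) + 8) + 8) + (5 + (2 + (n * (11 + 8) + 8)))))

theorem runs_ccProg {α : ℕ → ℕ → ℕ} (hα : IsDissatisfactionFamily α) (ℓ : Aggregation)
    {p : Prog} {m n t k w T : ℕ} (hp : Computes p (α m) m T) {E : Election m n}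
    {D : Fin m → Fin t} (hm : 1 ≤ m) (hk : 1 ≤ k) (h : E.WitnessesWidth D w) :
    Runs (ccProg ℓ p) (inputStore E D k) (ccTime ℓ m n k T (t * 2 ^ w)) fun s =>
      ∃ Φ : Fin n → Fin m, E.IsOptimalCC α ℓ k Φ ∧ ∀ v : Fin n, s.arr 2 v = (Φ v : ℕ) := by
  refine Runs.seq (runs_growTree (D := D) hm h.card_le rfl rfl rfl rfl rfl) ?_
  rintro s₁ hag₁ ⟨sets, size, hNle, h5, htree⟩
  set N := s₁.reg 4 with hN
  set sets' := Function.update sets 0 {0} with hsets'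
  have hfam := htree.isItemFamily hm
  rw [← h5, ← hsets'] at hfam
  -- The table `row` is fixed in advance by choice, so that the sets of the dynamic program do not
  -- depend on the run.
  have hrow : ∃ row, IsBestRow n N E.posNat sets' row := by
    have : ∀ v a, ∃ x, a < N → x ∈ sets' a ∧ ∀ c ∈ sets' a, E.posNat v x ≤ E.posNat v c := by
      intro v a
      by_cases ha : a < N
      · obtain ⟨x, hx⟩ := Finset.exists_min_image (sets' a) (E.posNat v)
          (htree.toIsSetTree.nonempty ha)
        exact ⟨x, fun _ => hx⟩
      · exact ⟨0, fun h => absurd h ha⟩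
    choose row hrow using this
    exact ⟨row, fun v _ a ha => hrow v a ha⟩
  obtain ⟨row, hrow⟩ := hrow
  refine Runs.seq (runs_initCells (k := k) (ℓ := ℓ) (pen := fun v c => α m (E.posNat v c))
    (row := row) (size := s₁.arr 5) (N := N) (hag₁.1 2 (by decide)) (hag₁.2 8 (by decide))) ?_
  rintro s₂ hag₂ ⟨hK, h9, h13, ht⟩
  have a3 : s₂.arr 3 = s₁.arr 3 := hag₂.2 3 (by decide)
  have a4 : s₂.arr 4 = s₁.arr 4 := hag₂.2 4 (by decide)
  have a5 : s₂.arr 5 = s₁.arr 5 := hag₂.2 5 (by decide)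
  have a0 : s₂.arr 0 = (inputStore E D k).arr 0 :=
    (hag₂.2 0 (by decide)).trans (hag₁.2 0 (by decide))
  have r0 : s₂.reg 0 = m := (hag₂.1 0 (by decide)).trans (hag₁.1 0 (by decide))
  have r1 : s₂.reg 1 = n := (hag₂.1 1 (by decide)).trans (hag₁.1 1 (by decide))
  have r2 : s₂.reg 2 = k := (hag₂.1 2 (by decide)).trans (hag₁.1 2 (by decide))
  rw [← a5] at ht hfam
  refine Runs.seq ((runs_voters hp (E := E) (row := row) (by rw [a3, a4]; exact htree.toIsSetTree)
    r0 r1 (hag₂.1 4 (by decide)) hK h9 h13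
    (fun v hv c hc => by rw [a0, E.inputStore_arr_zero D k hv hc]) hfam.subset hrow ht).mono
    (T' := n * (voterTime ℓ T (t * 2 ^ w) (k + 1) + 8) + 8) ?_ fun s' hs' => hs') ?_
  · unfold voterTime layerTime
    gcongr
  rintro s₃ hag₃ ⟨h13₃, ht₃⟩
  have r2₃ : s₃.reg 2 = k := (hag₃.1 2 (by simp)).trans r2
  have r1₃ : s₃.reg 1 = n := (hag₃.1 1 (by simp)).trans r1
  -- A constant assignment is feasible because `1 ≤ k`, so the final set is nonempty and its cell
  -- cannot hold 0.
  obtain ⟨l, hl, -⟩ := h.exists_mem_allAssign hα ℓ hfam hrow (k := k)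
    (Ψ := fun _ => ⟨0, hm⟩) ((Finset.card_le_card (Finset.image_subset_iff.2
      fun v _ => Finset.mem_singleton_self _)).trans (by simpa using hk))
  rcases ht₃.all k (Nat.lt_succ_self k) with ⟨-, hempty⟩ | ⟨l, hl, -, hlist, hmin⟩
  · rw [hempty] at hl
    exact hl.elim
  obtain ⟨Φ, hΦ, hf⟩ := h.exists_isOptimalCC hα ℓ hfam hrow hl hmin
  obtain ⟨f, hlf⟩ := exists_eq_prefixList l
  rw [length_of_mem_allAssign hl] at hlf
  rw [hlf] at hlist
  refine (runs_output (p := s₃.reg 20) r1₃ (by rw [h13₃, r2₃]; exact hlist)).mono le_rfl ?_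
  intro s₄ hs₄
  exact ⟨Φ, hΦ, fun v => by rw [hs₄ v v.isLt, hf f hlf v]⟩

end RAM

/-! ### The polynomial bound -/

theorem Election.WitnessesWidth.le {m n t w : ℕ} {E : Election m n} {D : Fin m → Fin t}
    (h : E.WitnessesWidth D w) : t ≤ m := by
  simpa using Fintype.card_le_of_surjective D h.nonempty

theorem proposition3 (α : ℕ → ℕ → ℕ) (hα : IsDissatisfactionFamily α)
    (hpoly : PolyTimeComputable α) (ℓ : Aggregation) :
    ∃ (P : RAM.Prog) (q : MvPolynomial (Fin 4) ℕ),
      ∀ (m n t k w : ℕ) (E : Election m n) (D : Fin m → Fin t),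
        1 ≤ m → 1 ≤ k → E.WitnessesWidth D w →
          ∃ (s : RAM.Store) (τ : ℕ),
            RAM.Exec P (inputStore E D k) s τ ∧
            τ ≤ MvPolynomial.eval ![m, n, k, 2 ^ w] q ∧
            ∃ Φ : Fin n → Fin m, E.IsOptimalCC α ℓ k Φ ∧
              ∀ v : Fin n, s.arr 2 v = (Φ v : ℕ) := by
  obtain ⟨p, r, hp⟩ := hpoly
  obtain ⟨q, hq⟩ : ∃ q : MvPolynomial (Fin 4) ℕ, ∀ m n k W : ℕ,
      MvPolynomial.eval ![m, n, k, W] q = RAM.ccTime ℓ m n k (r.eval m) (m * W) := by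
    let x : Fin 4 → MvPolynomial (Fin 4) ℕ := MvPolynomial.X
    let N := x 0 * x 3
    -- The time bound for `α`, with the variable for `m` substituted into it.
    let T := r.eval₂ MvPolynomial.C (x 0)
    let L := (x 2 + 1) * (5 + ((N * ((RAM.cellTime ℓ : ℕ) + 8) + 8) + 4) + 8) + 8
    let V := (N * (T + 50 + 8) + 8) + (4 + (2 + (L + 6)))
    refine ⟨(2 + ((x 0 * (2 + (N * ((RAM.growBody.bound : ℕ) + 8) + 8) + 8) + 8) + 3)) +
      ((4 + (2 + (2 + ((x 2 + 1) * (3 + 8) + 8)))) +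
      ((x 1 * (V + 8) + 8) + (5 + (2 + (x 1 * (11 + 8) + 8))))), fun m n k W => ?_⟩
    have hT : MvPolynomial.eval ![m, n, k, W] T = r.eval m := by
      simp only [T, x, Polynomial.hom_eval₂, MvPolynomial.eval_X]
      simp [Polynomial.eval, Polynomial.eval₂_eq_sum]
    simp [RAM.ccTime, RAM.voterTime, RAM.layerTime, L, V, N, x, hT]
  refine ⟨RAM.ccProg ℓ p, q, fun m n t k w E D hm hk h => ?_⟩
  have hcomp : RAM.Computes p (α m) m (r.eval m) := fun i h1 hi =>
    let ⟨s, τ, h₁, h₂, h₃⟩ := hp m i h1 hi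
    ⟨s, τ, h₁, h₂, h₃⟩
  -- The number of blocks is not a variable of the polynomial; `t ≤ m` and monotonicity of the time
  -- bound eliminate it.
  obtain ⟨s, τ, h₁, h₂, h₃⟩ := (RAM.runs_ccProg hα ℓ hcomp hm hk h).mono (T' :=
    RAM.ccTime ℓ m n k (r.eval m) (m * 2 ^ w)) (by
      have := h.le
      unfold RAM.ccTime RAM.voterTime RAM.layerTime
      gcongr) fun s hs => hs
  exact ⟨s, τ, h₁, by rwa [hq], h₃⟩
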